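/- Conventions. An almost contact metric structure $(I,\xi,\eta,g)$ on a smooth manifold $N$ consists of a smooth $(1,1)$-tensor field $I$, a smooth vector field $\xi$, a smooth $1$-form $\eta$ and a Riemannian metric $g$ with $I^2=-\mathrm{Id}+\eta\otimes\xi$, $\eta(\xi)=1$ and $g(IU,IV)=g(U,V)-\eta(U)\eta(V)$; its fundamental form is $\omega=g(\cdot,I\cdot)$. It is normal if the almost complex structure $(X,f\,\tfrac{d}{dt})\mapsto(IX+f\xi,\,-\eta(X)\tfrac{d}{dt})$ on $N\times\mathbb R$ is integrable; equivalently, $[I,I]+d\eta\otimes\xi=0$, where $[I,I](X,Y)=I^2[X,Y]+[IX,IY]-I[IX,Y]-I[X,IY]$ and $d\eta(X,Y)=X(\eta(Y))-Y(\eta(X))-\eta([X,Y])$. For an endomorphism field $A$ and a $k$-form $\beta$ put $(A\beta)(X_1,\dots,X_k)=\beta(AX_1,\dots,AX_k)$. A hyper-Hermitian structure $(J_1,J_2,J_3,h)$ consists of integrable complex structures with $J_1J_2=J_3=-J_2J_1$ and a Riemannian metric $h$ compatible with each $J_r$; with $F_r=h(\cdot,J_r\cdot)$ it is HKT if $J_1dF_1=J_2dF_2=J_3dF_3$,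 and an HKT structure is strong if its torsion $3$-form $-J_1dF_1$ is closed. Theorem. Let $N^{4n+3}$, $n\ge 0$, be a smooth manifold with three normal almost contact metric structures $(I_r,\xi_r,\eta_r,g)$, $r=1,2,3$, with the same metric $g$, such that for every cyclic permutation $(i,j,k)$ of $(1,2,3)$ $$I_k=I_iI_j-\eta_j\otimes\xi_i=-I_jI_i+\eta_i\otimes\xi_j,\qquad \xi_k=I_i\xi_j=-I_j\xi_i,\qquad \eta_k=\eta_i\circ I_j=-\eta_j\circ I_i ,$$ and let $\omega_r$ be their fundamental forms. Let $\Omega$ be a closed $2$-form on $N$ with $I_r\Omega=\Omega$ for $r=1,2,3$, which represents an integral cohomology class, and let $\pi:P\to N$ be a principal circle bundle with a connection $1$-form $\theta$ whose curvature is $d\theta=\pi^*\Omega$. (Here $\theta$ is real-valued and equals $1$ on the fundamental vector field of $t\mapsto e^{2\pi i t}$, so that a closed form $\Omega$ is the curvature of such a connection on some circle bundle exactly when its class is integral.) On $P$ define $J_1,J_2,J_3$ and $h$ by $$\theta(J_rX)=-\eta_r(\pi_*X),\qquad \pi_*(J_rX)=I_r(\pi_*X)+\theta(X)\,\xi_r,\qquad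 h(X,Y)=g(\pi_*X,\pi_*Y)+\theta(X)\theta(Y).$$ Then: 1. $(J_1,J_2,J_3,h)$ is a hyper-Hermitian structure on $P$. 2. It is HKT if and only if $$\pi^*\bigl(I_1d\omega_1-d\eta_1\wedge\eta_1\bigr)=\pi^*\bigl(I_2d\omega_2-d\eta_2\wedge\eta_2\bigr)=\pi^*\bigl(I_3d\omega_3-d\eta_3\wedge\eta_3\bigr)$$ and $$\pi^*\bigl(I_1(i_{\xi_1}d\omega_1)\bigr)=\pi^*\bigl(I_2(i_{\xi_2}d\omega_2)\bigr)=\pi^*\bigl(I_3(i_{\xi_3}d\omega_3)\bigr).$$ 3. If it is HKT, then the HKT structure is strong if and only if, for every $r=1,2,3$, $$d\bigl(\pi^*(I_r(i_{\xi_r}d\omega_r))\bigr)=0,\qquad d\bigl(\pi^*(I_r d\omega_r-d\eta_r\wedge\eta_r)\bigr)=\bigl(-\pi^*(I_r(i_{\xi_r}d\omega_r))+\pi^*\Omega\bigr)\wedge\pi^*\Omega .$$ -/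

import Mathlib

open scoped Manifold ContDiff

noncomputable section

namespace CircleHKT

/-! ### Tensor fields and differential forms on manifolds without boundary -/

section Fields

variable {m : ℕ} (M : Type*) [TopologicalSpace M] [ChartedSpace (EuclideanSpace ℝ (Fin m)) M]

/-- Vector fields on `M` (no regularity imposed). -/
abbrev VField : Type _ := (x : M) → TangentSpace (𝓡 m) x

/-- Fields of covectors on `M` (no regularity imposed). -/
abbrev CoField : Type _ := (x : M) → TangentSpace (𝓡 m) x →L[ℝ] ℝ

/-- Tensor fields of type `(1,1)` on `M` (no regularity imposed). -/
abbrev EndField : Type _ :=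
  (x : M) → TangentSpace (𝓡 m) x →L[ℝ] TangentSpace (𝓡 m) x

/-- Fields of bilinear forms on `M` (no regularity imposed). -/
abbrev BilinField : Type _ :=
  (x : M) → TangentSpace (𝓡 m) x →L[ℝ] TangentSpace (𝓡 m) x →L[ℝ] ℝ

/-- Differential `k`-forms on `M` (no regularity imposed). -/
abbrev DForm (k : ℕ) : Type _ := (x : M) → TangentSpace (𝓡 m) x [⋀^Fin k]→L[ℝ] ℝ

/-- Smooth Riemannian metrics on `M`. -/
abbrev RMetric [IsManifold (𝓡 m) ∞ M] : Type _ :=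
  Bundle.ContMDiffRiemannianMetric (𝓡 m) ∞ (EuclideanSpace ℝ (Fin m))
    (fun x : M => TangentSpace (𝓡 m) x)

end Fields

section Calculus

variable {m : ℕ} {M : Type*} [TopologicalSpace M] [ChartedSpace (EuclideanSpace ℝ (Fin m)) M]

/-- The vector field `X` is smooth at `x`. -/
def SmoothVFieldAt [IsManifold (𝓡 m) ∞ M] (X : VField (m := m) M) (x : M) : Prop :=
  ContMDiffAt (𝓡 m) (𝓡 m).tangent ∞ (fun y => (⟨y, X y⟩ : TangentBundle (𝓡 m) M)) x

/-- The `(1,1)`-tensor field `A` is smooth. -/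
def SmoothEnd [IsManifold (𝓡 m) ∞ M] (A : EndField (m := m) M) : Prop :=
  ContMDiff (𝓡 m)
    ((𝓡 m).prod 𝓘(ℝ, EuclideanSpace ℝ (Fin m) →L[ℝ] EuclideanSpace ℝ (Fin m))) ∞
    (fun x => Bundle.TotalSpace.mk'
      (EuclideanSpace ℝ (Fin m) →L[ℝ] EuclideanSpace ℝ (Fin m))
      (E := fun y : M => TangentSpace (𝓡 m) y →L[ℝ] TangentSpace (𝓡 m) y) x (A x))

/-- The local expression of the form `α` in the chart at `x₀`, that is, its pullback under the
inverse of that chart. -/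
def chartForm {k : ℕ} (α : DForm (m := m) M k) (x₀ : M) :
    EuclideanSpace ℝ (Fin m) → EuclideanSpace ℝ (Fin m) [⋀^Fin k]→L[ℝ] ℝ :=
  fun y => (α ((extChartAt (𝓡 m) x₀).symm y)).compContinuousLinearMap
    (mfderiv 𝓘(ℝ, EuclideanSpace ℝ (Fin m)) (𝓡 m) (extChartAt (𝓡 m) x₀).symm y)

/-- A form is smooth if its local expressions are. -/
def SmoothForm {k : ℕ} (α : DForm (m := m) M k) : Prop :=
  ∀ x₀ : M, ContDiffOn ℝ ∞ (chartForm α x₀) (extChartAt (𝓡 m) x₀).target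

/-- The exterior derivative of a form, computed at `x` in the chart at `x`. The normalization is
`dη(X,Y) = X(η(Y)) - Y(η(X)) - η([X,Y])`. -/
def extD {k : ℕ} (α : DForm (m := m) M k) : DForm (m := m) M (k + 1) :=
  fun x => (extDeriv (chartForm α x) (extChartAt (𝓡 m) x x)).compContinuousLinearMap
    (mfderiv (𝓡 m) 𝓘(ℝ, EuclideanSpace ℝ (Fin m)) (extChartAt (𝓡 m) x) x)

/-- A field of covectors as a `1`-form. -/
def oneForm (η : CoField (m := m) M) : DForm (m := m) M 1 :=
  fun x => ContinuousAlternatingMap.ofSubsingleton ℝ (TangentSpace (𝓡 m) x) ℝ (0 : Fin 1) (η x)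

/-- The interior product `i_ξ α = α(ξ, ·, …, ·)`. -/
def contract {k : ℕ} (ξ : VField (m := m) M) (α : DForm (m := m) M (k + 1)) :
    DForm (m := m) M k :=
  fun x => ContinuousAlternatingMap.curryLeft
    (E := EuclideanSpace ℝ (Fin m)) (α x) (ξ x)

/-- The action of a `(1,1)`-tensor field on forms,
`(A α)(X₁, …, X_k) = α(A X₁, …, A X_k)`. -/
def act {k : ℕ} (A : EndField (m := m) M) (α : DForm (m := m) M k) : DForm (m := m) M k :=
  fun x => (α x).compContinuousLinearMap (A x)

/-- The multilinear map `v ↦ a(v₁, …, v_k) b(v_{k+1}, …, v_{k+l})`. -/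
def mulAlt {V : Type*} [AddCommGroup V] [Module ℝ V] [TopologicalSpace V] {k l : ℕ}
    (a : V [⋀^Fin k]→L[ℝ] ℝ) (b : V [⋀^Fin l]→L[ℝ] ℝ) :
    ContinuousMultilinearMap ℝ (fun _ : Fin (k + l) => V) ℝ where
  toMultilinearMap := (LinearMap.mul' ℝ ℝ).compMultilinearMap
    ((MultilinearMap.domCoprod a.toAlternatingMap.toMultilinearMap
      b.toAlternatingMap.toMultilinearMap).domDomCongr finSumFinEquiv)
  cont := by
    have ha : Continuous fun v : Fin (k + l) → V => a (fun i => v (Fin.castAdd l i)) :=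
      a.cont.comp (continuous_pi fun i => continuous_apply _)
    have hb : Continuous fun v : Fin (k + l) → V => b (fun i => v (Fin.natAdd k i)) :=
      b.cont.comp (continuous_pi fun i => continuous_apply _)
    exact ha.mul hb

/-- The wedge product of alternating forms, with the normalization
`(a ∧ b)(v) = (1 / (k! l!)) ∑_σ sgn(σ) a(v_{σ 1}, …, v_{σ k}) b(v_{σ (k+1)}, …, v_{σ (k+l)})`;
for covectors, `(a ∧ b)(v, w) = a(v) b(w) - a(w) b(v)`. -/
def wedgeAlt {V : Type*} [AddCommGroup V] [Module ℝ V] [TopologicalSpace V] {k l : ℕ}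
    (a : V [⋀^Fin k]→L[ℝ] ℝ) (b : V [⋀^Fin l]→L[ℝ] ℝ) : V [⋀^Fin (k + l)]→L[ℝ] ℝ :=
  ((k.factorial * l.factorial : ℝ)⁻¹) • (mulAlt a b).alternatization

/-- The wedge product of differential forms. -/
def wedge {k l : ℕ} (α : DForm (m := m) M k) (β : DForm (m := m) M l) :
    DForm (m := m) M (k + l) :=
  fun x => wedgeAlt (α x) (β x)

/-- The alternating form `½ (b(v₀, A v₁) - b(v₁, A v₀))`, which is `b(v₀, A v₁)` itself if this
bilinear expression is skew-symmetric. -/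
def skewPart {V : Type*} [AddCommGroup V] [Module ℝ V] [TopologicalSpace V]
    (b : V →L[ℝ] V →L[ℝ] ℝ) (A : V →L[ℝ] V) (hb : Continuous fun p : V × V => b p.1 p.2) :
    V [⋀^Fin 2]→L[ℝ] ℝ where
  toFun v := (1 / 2 : ℝ) * (b (v 0) (A (v 1)) - b (v 1) (A (v 0)))
  map_update_add' v i x y := by
    fin_cases i <;> simp [Function.update] <;> ring
  map_update_smul' v i c x := by
    fin_cases i <;> simp [Function.update] <;> ring
  map_eq_zero_of_eq' v i j hv hij := by
    fin_cases i <;> fin_cases j <;> simp_all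
  cont := by
    have h0 : Continuous fun v : Fin 2 → V => b (v 0) (A (v 1)) :=
      hb.comp (f := fun v : Fin 2 → V => (v 0, A (v 1)))
        ((continuous_apply 0).prodMk (A.continuous.comp (continuous_apply 1)))
    have h1 : Continuous fun v : Fin 2 → V => b (v 1) (A (v 0)) :=
      hb.comp (f := fun v : Fin 2 → V => (v 1, A (v 0)))
        ((continuous_apply 1).prodMk (A.continuous.comp (continuous_apply 0)))
    exact continuous_const.mul (h0.sub h1)

theorem continuous_bilin (x : M)
    (b : TangentSpace (𝓡 m) x →L[ℝ] TangentSpace (𝓡 m) x →L[ℝ] ℝ) :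
    Continuous fun p : TangentSpace (𝓡 m) x × TangentSpace (𝓡 m) x => b p.1 p.2 := by
  let b' : EuclideanSpace ℝ (Fin m) →L[ℝ] EuclideanSpace ℝ (Fin m) →L[ℝ] ℝ := b
  exact b'.isBoundedBilinearMap.continuous

/-- The fundamental `2`-form `h(·, A ·)`. It is written as the skew part of this bilinear
expression, which makes it a `2`-form by construction. By `fundForm_apply` it is `h(·, A ·)` as soon
as the latter is skew-symmetric, in particular for almost contact metric and for almost Hermitian
structures. -/
def fundForm (h : BilinField (m := m) M) (A : EndField (m := m) M) : DForm (m := m) M 2 :=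
  fun x => skewPart (h x) (A x) (continuous_bilin x _)

theorem fundForm_apply (h : BilinField (m := m) M) (A : EndField (m := m) M) (x : M)
    (hskew : ∀ v w, h x v (A x w) = - h x w (A x v)) (v w : TangentSpace (𝓡 m) x) :
    fundForm h A x ![v, w] = h x v (A x w) := by
  change (1 / 2 : ℝ) * (h x v (A x w) - h x w (A x v)) = _
  rw [hskew w v]
  ring

/-- The Nijenhuis expression
`[A, A](X, Y) = A² [X, Y] + [A X, A Y] - A [A X, Y] - A [X, A Y]`. -/
def nijenhuis (A : EndField (m := m) M) (X Y : VField (m := m) M) : VField (m := m) M :=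
  fun x =>
    A x (A x (VectorField.mlieBracket (𝓡 m) X Y x))
      + VectorField.mlieBracket (𝓡 m) (fun y => A y (X y)) (fun y => A y (Y y)) x
      - A x (VectorField.mlieBracket (𝓡 m) (fun y => A y (X y)) Y x)
      - A x (VectorField.mlieBracket (𝓡 m) X (fun y => A y (Y y)) x)

end Calculus

/-! ### Almost contact metric structures -/

section Contact

variable {m : ℕ} {N : Type*} [TopologicalSpace N] [ChartedSpace (EuclideanSpace ℝ (Fin m)) N]
  [IsManifold (𝓡 m) ∞ N]

/-- `(A, ξ, η, g)` is an almost contact metric structure. -/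
structure IsAlmostContactMetric (A : EndField (m := m) N) (ξ : VField (m := m) N)
    (η : CoField (m := m) N) (g : RMetric (m := m) N) : Prop where
  smooth_end : SmoothEnd A
  smooth_vector : ∀ x, SmoothVFieldAt ξ x
  smooth_form : SmoothForm (oneForm η)
  sq : ∀ x v, A x (A x v) = -v + η x v • ξ x
  eta_xi : ∀ x, η x (ξ x) = 1
  compat : ∀ x v w, g.inner x (A x v) (A x w) = g.inner x v w - η x v * η x w

theorem IsAlmostContactMetric.apply_xi {A : EndField (m := m) N} {ξ : VField (m := m) N}
    {η : CoField (m := m) N} {g : RMetric (m := m) N} (H : IsAlmostContactMetric A ξ η g) (x : N) :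
    A x (ξ x) = 0 := by
  have h1 : A x (A x (ξ x)) = 0 := by simp [H.sq, H.eta_xi]
  have h2 := H.sq x (A x (ξ x))
  rw [h1, map_zero] at h2
  have h3 : A x (ξ x) = η x (A x (ξ x)) • ξ x := (neg_add_eq_zero.1 h2.symm)
  have h4 : η x (A x (ξ x)) • A x (ξ x) = 0 := by
    rw [← map_smul, ← h3, h1]
  rcases smul_eq_zero.1 h4 with h | h
  · rw [h3, h, zero_smul]
  · exact h

theorem IsAlmostContactMetric.eta_apply {A : EndField (m := m) N} {ξ : VField (m := m) N}
    {η : CoField (m := m) N} {g : RMetric (m := m) N} (H : IsAlmostContactMetric A ξ η g) (x : N)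
    (v : TangentSpace (𝓡 m) x) : η x (A x v) = 0 := by
  have h1 : A x (A x (A x v)) = - A x v := by
    rw [H.sq x v, map_add, map_neg, map_smul, H.apply_xi, smul_zero, add_zero]
  have h2 : η x (A x v) • ξ x = 0 := by simpa [h1] using H.sq x (A x v)
  simpa [H.eta_xi] using congrArg (η x) h2

/-- The fundamental form of an almost contact metric structure is `g(·, A ·)`. -/
theorem IsAlmostContactMetric.fundForm_apply {A : EndField (m := m) N} {ξ : VField (m := m) N}
    {η : CoField (m := m) N} {g : RMetric (m := m) N} (H : IsAlmostContactMetric A ξ η g) (x : N)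
    (v w : TangentSpace (𝓡 m) x) :
    fundForm (fun x => g.inner x) A x ![v, w] = g.inner x v (A x w) := by
  refine CircleHKT.fundForm_apply (fun x => g.inner x) A x (fun v w => ?_) v w
  have hxi : g.inner x (A x v) (ξ x) = 0 := by
    have := H.compat x (A x v) (ξ x)
    rw [H.apply_xi, H.eta_apply, map_zero, zero_mul, sub_zero] at this
    exact this.symm
  have h1 := H.compat x v (A x w)
  rw [H.eta_apply, mul_zero, sub_zero, H.sq, map_add, map_neg, map_smul, hxi] at h1
  rw [← h1, g.symm x w]
  simp

/-- Normality, `[A, A] + dη ⊗ ξ = 0`, which is the integrability of the almost complex structure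
`(X, f ∂ₜ) ↦ (A X + f ξ, -η(X) ∂ₜ)` on `N × ℝ`. With the convention
`dη(X,Y) = ½ (X(η(Y)) - Y(η(X)) - η([X,Y]))`, which is not the one used here, the same condition is
written `[A, A] + 2 dη ⊗ ξ = 0`. -/
def IsNormal (A : EndField (m := m) N) (ξ : VField (m := m) N) (η : CoField (m := m) N) : Prop :=
  ∀ (X Y : VField (m := m) N) (x : N), SmoothVFieldAt X x → SmoothVFieldAt Y x →
    nijenhuis A X Y x + extD (oneForm η) x ![X x, Y x] • ξ x = 0

/-- The quaternionic relations between three almost contact structures, for every cyclic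
permutation `(i, j, k)` of the three indices. -/
structure QuaternionicRelations (A : Fin 3 → EndField (m := m) N) (ξ : Fin 3 → VField (m := m) N)
    (η : Fin 3 → CoField (m := m) N) : Prop where
  end_left : ∀ (i : Fin 3) x v,
    A (i + 2) x v = A i x (A (i + 1) x v) - η (i + 1) x v • ξ i x
  end_right : ∀ (i : Fin 3) x v,
    A (i + 2) x v = - A (i + 1) x (A i x v) + η i x v • ξ (i + 1) x
  xi_left : ∀ (i : Fin 3) x, ξ (i + 2) x = A i x (ξ (i + 1) x)
  xi_right : ∀ (i : Fin 3) x, ξ (i + 2) x = - A (i + 1) x (ξ i x)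
  eta_left : ∀ (i : Fin 3) x v, η (i + 2) x v = η i x (A (i + 1) x v)
  eta_right : ∀ (i : Fin 3) x v, η (i + 2) x v = - η (i + 1) x (A i x v)

end Contact

/-! ### Hyper-Hermitian and HKT structures -/

section Hyper

variable {m : ℕ} {M : Type*} [TopologicalSpace M] [ChartedSpace (EuclideanSpace ℝ (Fin m)) M]
  [IsManifold (𝓡 m) ∞ M]

/-- `J` is an integrable almost complex structure. -/
structure IsComplexStructure (J : EndField (m := m) M) : Prop where
  smooth : SmoothEnd J
  sq : ∀ x v, J x (J x v) = -v
  integrable : ∀ (X Y : VField (m := m) M) (x : M), SmoothVFieldAt X x → SmoothVFieldAt Y x →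
    nijenhuis J X Y x = 0

/-- `(J₁, J₂, J₃, h)` is a hyper-Hermitian structure. -/
structure IsHyperHermitian (J : Fin 3 → EndField (m := m) M) (h : BilinField (m := m) M) :
    Prop where
  metric : ∃ h' : RMetric (m := m) M, ∀ x, h'.inner x = h x
  complex : ∀ r, IsComplexStructure (J r)
  quaternionic : ∀ x v, J 0 x (J 1 x v) = J 2 x v ∧ J 1 x (J 0 x v) = - J 2 x v
  compat : ∀ r x v w, h x (J r x v) (J r x w) = h x v w

/-- The fundamental forms of a hyper-Hermitian structure are `h(·, J_r ·)`. -/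
theorem IsHyperHermitian.fundForm_apply {J : Fin 3 → EndField (m := m) M}
    {h : BilinField (m := m) M} (H : IsHyperHermitian J h) (r : Fin 3) (x : M)
    (v w : TangentSpace (𝓡 m) x) : fundForm h (J r) x ![v, w] = h x v (J r x w) := by
  refine CircleHKT.fundForm_apply h (J r) x (fun v w => ?_) v w
  obtain ⟨g, hg⟩ := H.metric
  have h1 := H.compat r x v (J r x w)
  rw [(H.complex r).sq, map_neg] at h1
  rw [← h1, ← hg, g.symm x w]

/-- The `3`-form `J dF`, where `F = h(·, J ·)`. -/
def JdF (J : EndField (m := m) M) (h : BilinField (m := m) M) : DForm (m := m) M 3 :=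
  act J (extD (fundForm h J))

/-- An HKT structure: a hyper-Hermitian structure with `J₁ dF₁ = J₂ dF₂ = J₃ dF₃`. -/
def IsHKT (J : Fin 3 → EndField (m := m) M) (h : BilinField (m := m) M) : Prop :=
  IsHyperHermitian J h ∧ JdF (J 0) h = JdF (J 1) h ∧ JdF (J 1) h = JdF (J 2) h

/-- A strong HKT structure: one whose torsion `3`-form, `- J₁ dF₁ = - J₂ dF₂ = - J₃ dF₃`, is
closed. -/
def IsStrongHKT (J : Fin 3 → EndField (m := m) M) (h : BilinField (m := m) M) : Prop :=
  IsHKT J h ∧ extD (- JdF (J 0) h) = 0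

end Hyper

/-! ### Circle bundles and the induced structures -/

section CircleBundle

variable {m m' : ℕ}
  {N : Type*} [TopologicalSpace N] [ChartedSpace (EuclideanSpace ℝ (Fin m)) N]
  {P : Type*} [TopologicalSpace P] [ChartedSpace (EuclideanSpace ℝ (Fin m')) P]

/-- The pullback of forms along `π : P → N`. -/
def pullback (π : P → N) {k : ℕ} (α : DForm (m := m) N k) : DForm (m := m') P k :=
  fun p => (α (π p)).compContinuousLinearMap (mfderiv (𝓡 m') (𝓡 m) π p)

variable (m m') in
/-- `π : P → N` is a smooth principal bundle for the given action of the circle on `P`: the action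
is smooth, it preserves the fibres, and `π` has smooth equivariant local trivializations.
(The circle is abelian, so left and right actions are the same.) -/
structure IsPrincipalCircleBundle [MulAction Circle P] (π : P → N) : Prop where
  smooth_action : ContMDiff ((𝓡 1).prod (𝓡 m')) (𝓡 m') ∞ (fun q : Circle × P => q.1 • q.2)
  smooth_proj : ContMDiff (𝓡 m') (𝓡 m) ∞ π
  proj_smul : ∀ (z : Circle) (p : P), π (z • p) = π p
  locally_trivial : ∀ x : N, ∃ e : Bundle.Trivialization Circle π, x ∈ e.baseSet ∧
    ContMDiffOn (𝓡 m') ((𝓡 m).prod (𝓡 1)) ∞ e e.source ∧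
    ContMDiffOn ((𝓡 m).prod (𝓡 1)) (𝓡 m') ∞ e.toOpenPartialHomeomorph.symm e.target ∧
    ∀ (z : Circle), ∀ p ∈ e.source, (e (z • p)).2 = z * (e p).2

/-- `θ` is a connection `1`-form on the principal circle bundle `P`. The Lie algebra of the circle
is identified with `ℝ` in such a way that the exponential map is `t ↦ exp (2πit)`; thus `θ` takes
the value `1` on the velocity of `t ↦ exp (2πit) • p`. -/
structure IsConnectionForm [MulAction Circle P] (θ : CoField (m := m') P) : Prop where
  smooth : SmoothForm (oneForm θ)
  invariant : ∀ (z : Circle) (p : P) (v : TangentSpace (𝓡 m') p),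
    θ (z • p) (mfderiv (𝓡 m') (𝓡 m') (fun q : P => z • q) p v) = θ p v
  vertical : ∀ p : P,
    θ (Circle.exp (2 * Real.pi * 0) • p)
      (mfderiv 𝓘(ℝ, ℝ) (𝓡 m') (fun t : ℝ => Circle.exp (2 * Real.pi * t) • p) 0 (1 : ℝ)) = 1

variable (m) in
/-- The linear map `X ↦ (π_* X, θ(X))` from `T_p P` to `T_{π(p)} N × ℝ`; it is an isomorphism if
`θ` is a connection form, see `split_isInvertible`. -/
def split (π : P → N) (θ : CoField (m := m') P) (p : P) :
    TangentSpace (𝓡 m') p →L[ℝ] TangentSpace (𝓡 m) (π p) × ℝ :=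
  (mfderiv (𝓡 m') (𝓡 m) π p).prod (θ p)

theorem split_isInvertible {m : ℕ} [ChartedSpace (EuclideanSpace ℝ (Fin m)) N]
    [ChartedSpace (EuclideanSpace ℝ (Fin (m + 1))) P] [MulAction Circle P]
    {π : P → N} (hπ : IsPrincipalCircleBundle m (m + 1) π)
    {θ : CoField (m := m + 1) P} (hθ : IsConnectionForm θ) (p : P) :
    (split m π θ p).IsInvertible := by
  have hsurj : Function.Surjective (mfderiv (𝓡 (m + 1)) (𝓡 m) π p) := by
    obtain ⟨e, hx, -, hes, -⟩ := hπ.locally_trivial (π p)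
    have hp : p ∈ e.source := e.mem_source.2 hx
    set s : N → P := fun x => e.toOpenPartialHomeomorph.symm (x, (e p).2) with hs
    have hsp : s (π p) = p := by
      have : (π p, (e p).2) = e p := Prod.ext (e.proj_toFun p hp).symm rfl
      simp only [hs, this]
      exact e.left_inv hp
    have hmem : ∀ x ∈ e.baseSet, (x, (e p).2) ∈ e.target := fun x hx => by
      rw [e.target_eq]; exact ⟨hx, Set.mem_univ _⟩
    have hsd : MDifferentiableAt (𝓡 m) (𝓡 (m + 1)) s (π p) := by
      have h1 : ContMDiffAt ((𝓡 m).prod (𝓡 1)) (𝓡 (m + 1)) ∞ e.toOpenPartialHomeomorph.symm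
          (π p, (e p).2) :=
        hes.contMDiffAt (e.open_target.mem_nhds (hmem _ hx))
      have h2 : ContMDiffAt (𝓡 m) ((𝓡 m).prod (𝓡 1)) ∞ (fun x : N => (x, (e p).2)) (π p) :=
        contMDiffAt_id.prodMk contMDiffAt_const
      exact (ContMDiffAt.comp (π p) h1 h2).mdifferentiableAt (by simp)
    have hπd : MDifferentiableAt (𝓡 (m + 1)) (𝓡 m) π (s (π p)) :=
      (hπ.smooth_proj _).mdifferentiableAt (by simp)
    have hcomp := mfderiv_comp (π p) hπd hsd
    have hid : (π ∘ s) =ᶠ[nhds (π p)] id := by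
      filter_upwards [e.open_baseSet.mem_nhds hx] with x hx
      have h1 := e.proj_toFun _ (e.map_target (hmem x hx))
      have h2 : e.toOpenPartialHomeomorph (e.toOpenPartialHomeomorph.symm (x, (e p).2))
          = (x, (e p).2) := e.right_inv (hmem x hx)
      have h3 : x = π (s x) := by simpa [hs, h2] using h1
      exact h3.symm
    have key : Function.Surjective (mfderiv (𝓡 (m + 1)) (𝓡 m) π (s (π p))) := by
      intro w
      refine ⟨mfderiv (𝓡 m) (𝓡 (m + 1)) s (π p) w, ?_⟩
      have h1 := hid.mfderiv_eq (I := 𝓡 m) (I' := 𝓡 m)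
      rw [hcomp, mfderiv_id] at h1
      exact congrArg (fun L : EuclideanSpace ℝ (Fin m) →L[ℝ] EuclideanSpace ℝ (Fin m) => L w) h1
    have tr : ∀ q, q = p → Function.Surjective (mfderiv (𝓡 (m + 1)) (𝓡 m) π q) →
        Function.Surjective (mfderiv (𝓡 (m + 1)) (𝓡 m) π p) := by
      rintro q rfl h; exact h
    exact tr _ hsp key
  obtain ⟨V, hV0, hV1⟩ : ∃ V : TangentSpace (𝓡 (m + 1)) p,
      mfderiv (𝓡 (m + 1)) (𝓡 m) π p V = 0 ∧ θ p V = 1 := by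
    set c : ℝ → P := fun t => Circle.exp (2 * Real.pi * t) • p with hc
    have hc0 : c 0 = p := by simp [hc]
    have hcd : MDifferentiableAt 𝓘(ℝ, ℝ) (𝓡 (m + 1)) c 0 := by
      have h2 : ContMDiff 𝓘(ℝ, ℝ) ((𝓡 1).prod (𝓡 (m + 1))) ∞
          (fun t : ℝ => (Circle.exp (2 * Real.pi * t), p)) := by
        refine ContMDiff.prodMk (contMDiff_circleExp.comp ?_) contMDiff_const
        exact (contDiff_const.mul contDiff_id).contMDiff
      exact ((hπ.smooth_action.comp h2) 0).mdifferentiableAt (by simp)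
    have hπd : MDifferentiableAt (𝓡 (m + 1)) (𝓡 m) π (c 0) :=
      (hπ.smooth_proj _).mdifferentiableAt (by simp)
    have hcomp := mfderiv_comp (0 : ℝ) hπd hcd
    have hconst : π ∘ c = fun _ => π p := by
      funext t; exact hπ.proj_smul _ _
    have key : mfderiv (𝓡 (m + 1)) (𝓡 m) π (c 0)
        (mfderiv 𝓘(ℝ, ℝ) (𝓡 (m + 1)) c 0 (1 : ℝ)) = 0 := by
      rw [hconst, mfderiv_const] at hcomp
      exact (congrArg (fun L : ℝ →L[ℝ] EuclideanSpace ℝ (Fin m) => L 1) hcomp).symm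
    have tr : ∀ q, q = p → (∃ V : TangentSpace (𝓡 (m + 1)) q,
        mfderiv (𝓡 (m + 1)) (𝓡 m) π q V = 0 ∧ θ q V = 1) →
        ∃ V : TangentSpace (𝓡 (m + 1)) p,
          mfderiv (𝓡 (m + 1)) (𝓡 m) π p V = 0 ∧ θ p V = 1 := by
      rintro q rfl h; exact h
    exact tr _ hc0 ⟨_, key, hθ.vertical p⟩
  let f : EuclideanSpace ℝ (Fin (m + 1)) →L[ℝ] EuclideanSpace ℝ (Fin m) × ℝ := split m π θ p
  have hf : Function.Surjective f := by
    rintro ⟨w, t⟩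
    obtain ⟨X, hX⟩ := hsurj w
    let X' : EuclideanSpace ℝ (Fin (m + 1)) := X
    let V' : EuclideanSpace ℝ (Fin (m + 1)) := V
    refine ⟨X' + (t - θ p X) • V', Prod.ext ?_ ?_⟩
    · change mfderiv (𝓡 (m + 1)) (𝓡 m) π p (X + (t - θ p X) • V) = w
      rw [map_add, map_smul, hX, hV0, smul_zero]
      exact add_zero w
    · change θ p (X + (t - θ p X) • V) = t
      rw [map_add, map_smul, hV1]
      simp
  have hbij : Function.Bijective f :=
    ⟨(LinearMap.injective_iff_surjective_of_finrank_eq_finrank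
      (f := (f : EuclideanSpace ℝ (Fin (m + 1)) →ₗ[ℝ] EuclideanSpace ℝ (Fin m) × ℝ))
      (by simp)).2 hf, hf⟩
  let e := (LinearEquiv.ofBijective
    (f : EuclideanSpace ℝ (Fin (m + 1)) →ₗ[ℝ] EuclideanSpace ℝ (Fin m) × ℝ)
    hbij).toContinuousLinearEquiv
  exact ⟨e, by ext x <;> rfl⟩

/-- The almost complex structure `J` on `P` determined by
`θ(J X) = - η(π_* X)` and `π_* (J X) = A(π_* X) + θ(X) ξ`, see `bundleJ_spec`. -/
def bundleJ (π : P → N) (θ : CoField (m := m') P) (A : EndField (m := m) N)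
    (ξ : VField (m := m) N) (η : CoField (m := m) N) : EndField (m := m') P :=
  fun p => (split m π θ p).inverse ∘L
    ((A (π p) ∘L ContinuousLinearMap.fst ℝ (TangentSpace (𝓡 m) (π p)) ℝ
        + (ContinuousLinearMap.snd ℝ (TangentSpace (𝓡 m) (π p)) ℝ).smulRight (ξ (π p))).prod
      (- (η (π p) ∘L ContinuousLinearMap.fst ℝ (TangentSpace (𝓡 m) (π p)) ℝ))) ∘L
    split m π θ p

theorem bundleJ_spec {m : ℕ} [ChartedSpace (EuclideanSpace ℝ (Fin m)) N]
    [ChartedSpace (EuclideanSpace ℝ (Fin (m + 1))) P] [MulAction Circle P]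
    {π : P → N} (hπ : IsPrincipalCircleBundle m (m + 1) π)
    {θ : CoField (m := m + 1) P} (hθ : IsConnectionForm θ)
    (A : EndField (m := m) N) (ξ : VField (m := m) N) (η : CoField (m := m) N)
    (p : P) (X : TangentSpace (𝓡 (m + 1)) p) :
    θ p (bundleJ π θ A ξ η p X) = - η (π p) (mfderiv (𝓡 (m + 1)) (𝓡 m) π p X) ∧
    mfderiv (𝓡 (m + 1)) (𝓡 m) π p (bundleJ π θ A ξ η p X) =
      A (π p) (mfderiv (𝓡 (m + 1)) (𝓡 m) π p X) + θ p X • ξ (π p) := by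
  have h : split m π θ p (bundleJ π θ A ξ η p X) =
      (A (π p) (mfderiv (𝓡 (m + 1)) (𝓡 m) π p X) + θ p X • ξ (π p),
        - η (π p) (mfderiv (𝓡 (m + 1)) (𝓡 m) π p X)) := by
    obtain ⟨e, he⟩ := split_isInvertible hπ hθ p
    have h1 : ∀ y, split m π θ p ((split m π θ p).inverse y) = y := by
      intro y
      rw [← he, ContinuousLinearMap.inverse_equiv]
      exact e.apply_symm_apply y
    exact h1 _
  exact ⟨congrArg Prod.snd h, congrArg Prod.fst h⟩

/-- The metric `h(X, Y) = g(π_* X, π_* Y) + θ(X) θ(Y)` on `P`. -/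
def bundleMetric [IsManifold (𝓡 m) ∞ N] (π : P → N) (θ : CoField (m := m') P)
    (g : RMetric (m := m) N) : BilinField (m := m') P :=
  fun p => (ContinuousLinearMap.precomp ℝ (mfderiv (𝓡 m') (𝓡 m) π p)) ∘L g.inner (π p) ∘L
      mfderiv (𝓡 m') (𝓡 m) π p
    + (θ p).smulRight (θ p)

theorem bundleMetric_apply [IsManifold (𝓡 m) ∞ N] (π : P → N) (θ : CoField (m := m') P)
    (g : RMetric (m := m) N) (p : P) (X Y : TangentSpace (𝓡 m') p) :
    bundleMetric π θ g p X Y =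
      g.inner (π p) (mfderiv (𝓡 m') (𝓡 m) π p X) (mfderiv (𝓡 m') (𝓡 m) π p Y)
        + θ p X * θ p Y := rfl

end CircleBundle

end CircleHKT

end

open CircleHKT

/-! The connection form splits every tangent space of `P` as `X ↦ (π_* X, θ(X))`, so an identity on
`P` may be checked on its base component and its vertical component. Three computations then carry
the theorem.

Integrability. In the splitting, `J_r` copies the almost complex structure on `N × ℝ` that defines
normality, with `θ` in the role of `dt`. Normality forces `L_ξ I = 0`, `L_ξ η = 0` and `dη(I·, I·) =
dη` (`NormalJet.lie_end`, `NormalJet.lie_eta`, `NormalJet.extD_invariant`). The only new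
contribution to the Nijenhuis tensor of `J` comes from `dθ = π^*Ω`. Since `IΩ = Ω` and `Iξ = 0`, the
form `Ω` annihilates `ξ`, and therefore `π^*Ω` is `J`-invariant, which is exactly what makes this
contribution vanish (`NormalJet.nijAlg_eq_zero`). The quaternionic relations and the compatibility
of the metric are algebra in the splitting.

Torsion. From `g(·, ξ) = η` one gets `F = π^*ω + π^*η ∧ θ`, hence `dF = π^*dω + π^*dη ∧ θ - π^*η ∧
π^*Ω`. Since `π^*η ∘ J = θ`, `θ ∘ J = -π^*η`, and `π^*dη`, `π^*Ω` are `J`-invariant, applying `J`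
gives `J dF = π^*B + θ ∧ π^*(C - Ω)` with `B = I dω - dη ∧ η` and `C = I(i_ξ dω)` (`JdF_eq`).

Conditions. Contraction with a vertical vector on which `θ = 1` separates the two summands, so the
three torsions agree exactly when the pullbacks of the `B_r` agree and those of the `C_r` agree
(`torsionForm_eq_iff`). As `dΩ = 0`, the derivative of the torsion form is `π^*dB + π^*Ω ∧ π^*(C -
Ω) - θ ∧ π^*dC`, and the same contraction separates the two equations of the strong condition
(`dThree_torsionForm_eq_zero_iff`).

The calculus takes place in the preferred chart at each point, whose derivative there is the
identity. Tensors at the point then coincide with their local expressions, and the manifold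
statements become identities between derivatives of maps of Euclidean spaces. -/

namespace CircleHKT

noncomputable section

set_option linter.unusedSectionVars false

/-! ### Charts and local expressions -/

/-- The model space of an `m`-dimensional manifold. -/
abbrev Eucl (m : ℕ) : Type := EuclideanSpace ℝ (Fin m)

section Chart

variable {m : ℕ} {M : Type*} [TopologicalSpace M] [ChartedSpace (Eucl m) M]

/-- The derivative of the inverse of the chart at `x₀`. -/
def chartD (x₀ : M) (y : Eucl m) : Eucl m →L[ℝ] Eucl m :=
  mfderiv 𝓘(ℝ, Eucl m) (𝓡 m) (extChartAt (𝓡 m) x₀).symm y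

/-- The derivative of the chart at `x₀`. -/
def chartDinv (x₀ : M) (z : M) : Eucl m →L[ℝ] Eucl m :=
  mfderiv (𝓡 m) 𝓘(ℝ, Eucl m) (extChartAt (𝓡 m) x₀) z

variable [IsManifold (𝓡 m) ∞ M]

theorem isManifold_one : IsManifold (𝓡 m) 1 M := .of_le (n := ∞) (by simp)

theorem chartDinv_chartD {x₀ : M} {y : Eucl m} (hy : y ∈ (extChartAt (𝓡 m) x₀).target)
    (v : Eucl m) : chartDinv x₀ ((extChartAt (𝓡 m) x₀).symm y) (chartD x₀ y v) = v := by
  have := isManifold_one (m := m) (M := M)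
  have h := mfderiv_extChartAt_comp_mfderivWithin_extChartAt_symm (I := 𝓡 m) hy
  simp only [modelWithCornersSelf_coe, Set.range_id, mfderivWithin_univ] at h
  exact congrArg (fun L : Eucl m →L[ℝ] Eucl m => L v) h

theorem chartD_chartDinv {x₀ : M} {y : Eucl m} (hy : y ∈ (extChartAt (𝓡 m) x₀).target)
    (v : Eucl m) : chartD x₀ y (chartDinv x₀ ((extChartAt (𝓡 m) x₀).symm y) v) = v := by
  have := isManifold_one (m := m) (M := M)
  have h := mfderivWithin_extChartAt_symm_comp_mfderiv_extChartAt (I := 𝓡 m) hy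
  simp only [modelWithCornersSelf_coe, Set.range_id, mfderivWithin_univ] at h
  exact congrArg (fun L : Eucl m →L[ℝ] Eucl m => L v) h

/-- Tangent vectors at `x` are represented in the preferred chart at `x`, so no coordinate change is
left at the base point. This is what allows tensors at `x` to be compared directly with the values
and derivatives of local expressions. -/
theorem chartDinv_self (x : M) : chartDinv x x = ContinuousLinearMap.id ℝ (Eucl m) := by
  have := isManifold_one (m := m) (M := M)
  exact mfderiv_extChartAt_self

theorem chartD_self (x : M) :
    chartD x (extChartAt (𝓡 m) x x) = ContinuousLinearMap.id ℝ (Eucl m) := by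
  ext1 v
  have h := chartDinv_chartD (mem_extChartAt_target (I := 𝓡 m) x) v
  rw [extChartAt_to_inv, chartDinv_self] at h
  exact h

end Chart

/-! ### Smoothness of maps with values in alternating forms -/

section Alternating

variable {m : ℕ}

/-- The components of an alternating form. -/
def altComponents (m k : ℕ) :
    (Eucl m [⋀^Fin k]→L[ℝ] ℝ) →ₗ[ℝ] ((Fin k → Fin m) → ℝ) where
  toFun a i := a (fun j => EuclideanSpace.basisFun (Fin m) ℝ (i j))
  map_add' _ _ := rfl
  map_smul' _ _ := rfl

theorem altComponents_injective (m k : ℕ) : Function.Injective (altComponents m k) := by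
  intro a b h
  apply ContinuousAlternatingMap.toAlternatingMap_injective
  refine Module.Basis.ext_alternating (EuclideanSpace.basisFun (Fin m) ℝ).toBasis fun i _ => ?_
  simpa [altComponents] using congrFun h i

/-- Finite dimension makes the linear map `altComponents` continuous, hence smooth. -/
instance (k : ℕ) : FiniteDimensional ℝ (Eucl m [⋀^Fin k]→L[ℝ] ℝ) :=
  FiniteDimensional.of_injective _ (altComponents_injective m k)

/-- A map with values in alternating forms is smooth if its values on constant vectors are. -/
theorem contDiffAt_alt {V : Type*} [NormedAddCommGroup V] [NormedSpace ℝ V] {k : ℕ}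
    {a : V → Eucl m [⋀^Fin k]→L[ℝ] ℝ} {x : V}
    (h : ∀ v : Fin k → Eucl m, ContDiffAt ℝ ∞ (fun y => a y v) x) : ContDiffAt ℝ ∞ a x := by
  -- A linear left inverse of the component map rebuilds the form from its scalar components. It is
  -- continuous because its source is finite-dimensional.
  obtain ⟨L, hL⟩ := LinearMap.exists_leftInverse_of_injective (altComponents m k)
    (LinearMap.ker_eq_bot.2 (altComponents_injective m k))
  have h1 : a = fun y => L.toContinuousLinearMap (altComponents m k (a y)) := by
    funext y
    exact (congrArg (fun f => f (a y)) hL).symm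
  rw [h1]
  refine L.toContinuousLinearMap.contDiff.contDiffAt.comp x ?_
  exact contDiffAt_pi.2 fun i => h _

/-- The evaluation of a smooth form on smooth vectors is smooth. -/
theorem ContDiffAt.alt_apply {V : Type*} [NormedAddCommGroup V] [NormedSpace ℝ V] {k : ℕ}
    {a : V → Eucl m [⋀^Fin k]→L[ℝ] ℝ} {w : V → Fin k → Eucl m} {x : V}
    (ha : ContDiffAt ℝ ∞ a x) (hw : ∀ j, ContDiffAt ℝ ∞ (fun y => w y j) x) :
    ContDiffAt ℝ ∞ (fun y => a y (w y)) x := by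
  -- By multilinearity the value is a polynomial in the coordinates of the vectors and the
  -- components of the form.
  have hexp : ∀ y, a y (w y) = ∑ i : Fin k → Fin m, (∏ j, w y j (i j)) *
      a y (fun j => EuclideanSpace.basisFun (Fin m) ℝ (i j)) := by
    intro y
    have h1 : w y = fun j => ∑ l, w y j l • EuclideanSpace.basisFun (Fin m) ℝ l := by
      funext j
      have := (EuclideanSpace.basisFun (Fin m) ℝ).sum_repr (w y j)
      simpa using this.symm
    conv_lhs => rw [h1]
    have h2 := (a y).toMultilinearMap.map_sum
      (g := fun j l => w y j l • EuclideanSpace.basisFun (Fin m) ℝ l)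
    refine h2.trans (Finset.sum_congr rfl fun i _ => ?_)
    exact (a y).toMultilinearMap.map_smul_univ (fun j => w y j (i j)) _
  simp only [hexp]
  refine ContDiffAt.sum fun i _ => ContDiffAt.mul ?_ ?_
  · refine contDiffAt_prod fun j _ => ?_
    exact (EuclideanSpace.proj (𝕜 := ℝ) (i j)).contDiff.contDiffAt.comp x (hw j)
  · exact (contDiffAt_pi.1
      ((altComponents m k).toContinuousLinearMap.contDiff.contDiffAt.comp x ha) i)

end Alternating

/-! ### Pullbacks and the exterior derivative in charts -/

section Pullback

variable {m m' : ℕ}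
  {N : Type*} [TopologicalSpace N] [ChartedSpace (Eucl m) N] [IsManifold (𝓡 m) ∞ N]
  {P : Type*} [TopologicalSpace P] [ChartedSpace (Eucl m') P] [IsManifold (𝓡 m') ∞ P]

/-- The local expression of a map in the charts at `x₀` and `x₁`. -/
def chartMap (f : P → N) (x₀ : P) (x₁ : N) : Eucl m' → Eucl m :=
  fun y => extChartAt (𝓡 m) x₁ (f ((extChartAt (𝓡 m') x₀).symm y))

theorem contDiffAt_chartMap {f : P → N} {x₀ : P} {x₁ : N} {y : Eucl m'}
    (hf : ContMDiff (𝓡 m') (𝓡 m) ∞ f) (hy : y ∈ (extChartAt (𝓡 m') x₀).target)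
    (hy' : f ((extChartAt (𝓡 m') x₀).symm y) ∈ (extChartAt (𝓡 m) x₁).source) :
    ContDiffAt ℝ ∞ (chartMap (m := m) (m' := m') f x₀ x₁) y := by
  rw [← contMDiffAt_iff_contDiffAt]
  have h1 : ContMDiffAt 𝓘(ℝ, Eucl m') (𝓡 m') ∞ (extChartAt (𝓡 m') x₀).symm y :=
    (contMDiffOn_extChartAt_symm x₀).contMDiffAt ((isOpen_extChartAt_target x₀).mem_nhds hy)
  have h2 : ContMDiffAt (𝓡 m) 𝓘(ℝ, Eucl m) ∞ (extChartAt (𝓡 m) x₁)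
      (f ((extChartAt (𝓡 m') x₀).symm y)) :=
    contMDiffAt_extChartAt' (by simpa using hy')
  exact h2.comp y ((hf _).comp y h1)

theorem fderiv_chartMap {f : P → N} {x₀ : P} {x₁ : N} {y : Eucl m'}
    (hf : ContMDiff (𝓡 m') (𝓡 m) ∞ f) (hy : y ∈ (extChartAt (𝓡 m') x₀).target)
    (hy' : f ((extChartAt (𝓡 m') x₀).symm y) ∈ (extChartAt (𝓡 m) x₁).source) (v : Eucl m') :
    fderiv ℝ (chartMap f x₀ x₁) y v =
      chartDinv x₁ (f ((extChartAt (𝓡 m') x₀).symm y))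
        (mfderiv (𝓡 m') (𝓡 m) f ((extChartAt (𝓡 m') x₀).symm y) (chartD x₀ y v)) := by
  have h1 : MDifferentiableAt 𝓘(ℝ, Eucl m') (𝓡 m') (extChartAt (𝓡 m') x₀).symm y :=
    ((contMDiffOn_extChartAt_symm (n := ∞) x₀).contMDiffAt
      ((isOpen_extChartAt_target x₀).mem_nhds hy)).mdifferentiableAt (by simp)
  have h2 : MDifferentiableAt (𝓡 m) 𝓘(ℝ, Eucl m) (extChartAt (𝓡 m) x₁)
      (f ((extChartAt (𝓡 m') x₀).symm y)) :=
    (contMDiffAt_extChartAt' (n := ∞) (by simpa using hy')).mdifferentiableAt (by simp)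
  have h3 : MDifferentiableAt (𝓡 m') (𝓡 m) f ((extChartAt (𝓡 m') x₀).symm y) :=
    (hf _).mdifferentiableAt (by simp)
  have h4 := mfderiv_comp y (h2.comp _ h3) h1
  rw [mfderiv_comp _ h2 h3, mfderiv_eq_fderiv] at h4
  exact congrArg (fun L : Eucl m' →L[ℝ] Eucl m => L v) h4

/-- By the chain rule the derivative of `chartMap` ends with the derivative of the chart at `x₁`,
which cancels against the inverse chart inside `chartForm`. The chart at `x₁` need not be the
preferred one at the image point, so that the identity map also yields changes of charts. -/
theorem chartForm_pullback {f : P → N} {x₀ : P} {x₁ : N} {y : Eucl m'} {k : ℕ}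
    (hf : ContMDiff (𝓡 m') (𝓡 m) ∞ f) (hy : y ∈ (extChartAt (𝓡 m') x₀).target)
    (hy' : f ((extChartAt (𝓡 m') x₀).symm y) ∈ (extChartAt (𝓡 m) x₁).source)
    (α : DForm (m := m) N k) :
    chartForm (pullback (m' := m') f α) x₀ y =
      (chartForm α x₁ (chartMap f x₀ x₁ y)).compContinuousLinearMap
        (fderiv ℝ (chartMap f x₀ x₁) y) := by
  let α' : N → Eucl m [⋀^Fin k]→L[ℝ] ℝ := α
  ext v
  have h5 : (extChartAt (𝓡 m) x₁).symm (chartMap f x₀ x₁ y) = f ((extChartAt (𝓡 m') x₀).symm y) :=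
    (extChartAt (𝓡 m) x₁).left_inv hy'
  have h6 : chartMap f x₀ x₁ y ∈ (extChartAt (𝓡 m) x₁).target := (extChartAt _ x₁).map_source hy'
  change α' (f ((extChartAt (𝓡 m') x₀).symm y)) (fun j => mfderiv (𝓡 m') (𝓡 m) f
      ((extChartAt (𝓡 m') x₀).symm y) (chartD x₀ y (v j))) =
    α' ((extChartAt (𝓡 m) x₁).symm (chartMap f x₀ x₁ y))
      (fun j => chartD x₁ (chartMap f x₀ x₁ y) (fderiv ℝ (chartMap f x₀ x₁) y (v j)))
  rw [h5]
  congr 1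
  funext j
  rw [fderiv_chartMap hf hy hy', ← h5]
  exact (chartD_chartDinv h6 _).symm

/-- The set of points at which a chart expression of a map near a base point is defined. -/
theorem eventually_chart {f : P → N} (hf : ContMDiff (𝓡 m') (𝓡 m) ∞ f) (x₀ : P) :
    ∀ᶠ y in nhds (extChartAt (𝓡 m') x₀ x₀), y ∈ (extChartAt (𝓡 m') x₀).target ∧
      f ((extChartAt (𝓡 m') x₀).symm y) ∈ (extChartAt (𝓡 m) (f x₀)).source := by
  refine Filter.Eventually.and (extChartAt_target_mem_nhds x₀) ?_
  have h1 : ContinuousAt (fun y => f ((extChartAt (𝓡 m') x₀).symm y))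
      (extChartAt (𝓡 m') x₀ x₀) := by
    refine ContinuousAt.comp ?_ (continuousAt_extChartAt_symm x₀)
    exact hf.continuous.continuousAt
  refine h1.preimage_mem_nhds ?_
  rw [extChartAt_to_inv]
  exact extChartAt_source_mem_nhds (f x₀)

theorem chartMap_self (f : P → N) (x₀ : P) :
    chartMap (m := m) (m' := m') f x₀ (f x₀) (extChartAt (𝓡 m') x₀ x₀) =
      extChartAt (𝓡 m) (f x₀) (f x₀) := by
  simp [chartMap]

/-- The derivative of the local expression of a map at the base point. -/
theorem fderiv_chartMap_self {f : P → N} (hf : ContMDiff (𝓡 m') (𝓡 m) ∞ f) (x₀ : P)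
    (v : Eucl m') :
    fderiv ℝ (chartMap (m := m) (m' := m') f x₀ (f x₀)) (extChartAt (𝓡 m') x₀ x₀) v =
      mfderiv (𝓡 m') (𝓡 m) f x₀ v := by
  obtain ⟨h1, h2⟩ := (eventually_chart hf x₀).self_of_nhds
  rw [fderiv_chartMap hf h1 h2, chartD_self, extChartAt_to_inv, chartDinv_self]
  rfl

end Pullback

/-! ### Smooth forms and naturality of the exterior derivative. -/

section Smooth

variable {m m' : ℕ}
  {N : Type*} [TopologicalSpace N] [ChartedSpace (Eucl m) N] [IsManifold (𝓡 m) ∞ N]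
  {P : Type*} [TopologicalSpace P] [ChartedSpace (Eucl m') P] [IsManifold (𝓡 m') ∞ P]

/-- A form whose local expression in the chart at each point is smooth at that point. -/
def FormSmooth {k : ℕ} (α : DForm (m := m) N k) : Prop :=
  ∀ x : N, ContDiffAt ℝ ∞ (chartForm α x) (extChartAt (𝓡 m) x x)

theorem SmoothForm.formSmooth {k : ℕ} {α : DForm (m := m) N k} (h : SmoothForm α) :
    FormSmooth α :=
  fun x => (h x).contDiffAt (extChartAt_target_mem_nhds x)

theorem chartForm_self {k : ℕ} (α : DForm (m := m) N k) (x : N) :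
    chartForm α x (extChartAt (𝓡 m) x x) = α x := by
  let α' : N → Eucl m [⋀^Fin k]→L[ℝ] ℝ := α
  change (α' ((extChartAt (𝓡 m) x).symm (extChartAt (𝓡 m) x x))).compContinuousLinearMap
    (chartD x (extChartAt (𝓡 m) x x)) = α' x
  rw [chartD_self, extChartAt_to_inv]
  ext v
  rfl

theorem extD_eq {k : ℕ} (α : DForm (m := m) N k) (x : N) :
    extD α x = extDeriv (chartForm α x) (extChartAt (𝓡 m) x x) := by
  change (extDeriv (chartForm α x) (extChartAt (𝓡 m) x x)).compContinuousLinearMap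
    (chartDinv x x) = _
  rw [chartDinv_self]
  ext v
  rfl

theorem FormSmooth.differentiableAt {k : ℕ} {α : DForm (m := m) N k} (h : FormSmooth α) (x : N) :
    DifferentiableAt ℝ (chartForm α x) (extChartAt (𝓡 m) x x) :=
  (h x).differentiableAt (by simp)

theorem chartForm_pullback_eventuallyEq {f : P → N} (hf : ContMDiff (𝓡 m') (𝓡 m) ∞ f) {k : ℕ}
    (α : DForm (m := m) N k) (p : P) :
    chartForm (pullback (m' := m') f α) p =ᶠ[nhds (extChartAt (𝓡 m') p p)]
      fun y => (chartForm α (f p) (chartMap f p (f p) y)).compContinuousLinearMap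
        (fderiv ℝ (chartMap f p (f p)) y) := by
  filter_upwards [eventually_chart hf p] with y hy
  exact chartForm_pullback hf hy.1 hy.2 α

theorem FormSmooth.pullback {f : P → N} (hf : ContMDiff (𝓡 m') (𝓡 m) ∞ f) {k : ℕ}
    {α : DForm (m := m) N k} (hα : FormSmooth α) :
    FormSmooth (pullback (m' := m') f α) := by
  intro p
  obtain ⟨h1, h2⟩ := (eventually_chart hf p).self_of_nhds
  have hc := contDiffAt_chartMap hf h1 h2
  refine ContDiffAt.congr_of_eventuallyEq ?_ (chartForm_pullback_eventuallyEq hf α p)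
  refine contDiffAt_alt fun v => ?_
  change ContDiffAt ℝ ∞ (fun y => chartForm α (f p) (chartMap f p (f p) y)
    (fun j => fderiv ℝ (chartMap f p (f p)) y (v j))) _
  refine ContDiffAt.alt_apply ?_ fun j => ?_
  · refine ContDiffAt.comp (g := chartForm α (f p)) _ ?_ hc
    rw [chartMap_self]
    exact hα (f p)
  · exact (hc.fderiv_right (m := ∞) (by simp)).clm_apply contDiffAt_const

theorem minSmoothness_two_le : minSmoothness ℝ 2 ≤ (∞ : WithTop ℕ∞) := by
  rw [minSmoothness_of_isRCLikeNormedField]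
  exact WithTop.coe_le_coe.2 (le_top : (2 : ℕ∞) ≤ ⊤)

/-- The exterior derivative commutes with pullbacks. -/
theorem extD_pullback {f : P → N} (hf : ContMDiff (𝓡 m') (𝓡 m) ∞ f) {k : ℕ}
    {α : DForm (m := m) N k} (hα : FormSmooth α) :
    extD (CircleHKT.pullback (m' := m') f α) = CircleHKT.pullback (m' := m') f (extD α) := by
  funext p
  obtain ⟨h1, h2⟩ := (eventually_chart hf p).self_of_nhds
  have hc := contDiffAt_chartMap hf h1 h2
  rw [extD_eq, (chartForm_pullback_eventuallyEq hf α p).extDeriv_eq,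
    extDeriv_pullback (r := ∞) (by rw [chartMap_self]; exact hα.differentiableAt (f p)) hc
      minSmoothness_two_le, chartMap_self, ← extD_eq]
  ext v
  refine congrArg (extD α (f p)) ?_
  funext j
  exact fderiv_chartMap_self hf p (v j)

/-- The exterior derivative can be computed in any chart. -/
theorem chartForm_extD {k : ℕ} {α : DForm (m := m) N k} (hα : FormSmooth α) (x : N)
    {y : Eucl m} (hy : y ∈ (extChartAt (𝓡 m) x).target) :
    chartForm (extD α) x y = extDeriv (chartForm α x) y := by
  let z := (extChartAt (𝓡 m) x).symm y
  -- The change of charts from `x` to `z` is the local expression of the identity map. Independence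
  -- of the chart is thus an instance of `d` commuting with pullbacks.
  have hid : ContMDiff (𝓡 m) (𝓡 m) ∞ (id : N → N) := contMDiff_id
  have hz : z ∈ (extChartAt (𝓡 m) z).source := mem_extChartAt_source z
  have hpull : ∀ {l : ℕ} (β : DForm (m := m) N l),
      CircleHKT.pullback (m' := m) (id : N → N) β = β := by
    intro l β
    funext p
    ext v
    refine congrArg (β p) ?_
    funext j
    simp only [mfderiv_id]
    rfl
  have hev : ∀ᶠ y' in nhds y, y' ∈ (extChartAt (𝓡 m) x).target ∧
      (extChartAt (𝓡 m) x).symm y' ∈ (extChartAt (𝓡 m) z).source := by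
    refine Filter.Eventually.and ((isOpen_extChartAt_target x).mem_nhds hy) ?_
    exact (continuousAt_extChartAt_symm'' hy).preimage_mem_nhds (extChartAt_source_mem_nhds z)
  have heq : chartForm α x =ᶠ[nhds y] fun y' =>
      (chartForm α z (chartMap (id : N → N) x z y')).compContinuousLinearMap
        (fderiv ℝ (chartMap (id : N → N) x z) y') := by
    filter_upwards [hev] with y' hy'
    have := chartForm_pullback hid hy'.1 hy'.2 α
    rwa [hpull] at this
  have hc := contDiffAt_chartMap (x₀ := x) (x₁ := z) hid hy hz
  have hbase : chartMap (id : N → N) x z y = extChartAt (𝓡 m) z z := rfl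
  have h3 := chartForm_pullback hid hy hz (extD α)
  rw [hpull] at h3
  rw [h3, heq.extDeriv_eq, extDeriv_pullback (r := ∞) (f := chartMap (id : N → N) x z)
    (hα.differentiableAt z) hc minSmoothness_two_le, hbase, chartForm_self, extD_eq]

/-- The definition of `extD` uses a different chart at each point. By `chartForm_extD` a single
chart serves a whole neighbourhood, where `extDeriv` is a continuous linear map applied to the
smooth derivative. -/
theorem FormSmooth.extD {k : ℕ} {α : DForm (m := m) N k} (hα : FormSmooth α) :
    FormSmooth (extD α) := by
  intro x
  have h1 : chartForm (CircleHKT.extD α) x =ᶠ[nhds (extChartAt (𝓡 m) x x)]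
      extDeriv (chartForm α x) := by
    filter_upwards [extChartAt_target_mem_nhds (I := 𝓡 m) x] with y hy
    exact chartForm_extD hα x hy
  refine ContDiffAt.congr_of_eventuallyEq ?_ h1
  have h2 := (hα x).fderiv_right (m := ∞) (by simp)
  exact (ContinuousAlternatingMap.alternatizeUncurryFinCLM ℝ (Eucl m) ℝ).contDiff.contDiffAt.comp
    _ h2

end Smooth

/-! ### Tensor fields in charts -/

section Fields

variable {m : ℕ} {M : Type*} [TopologicalSpace M] [ChartedSpace (Eucl m) M]

/-- The local expression of a field of endomorphisms in the chart at `x₀`. -/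
def locEnd (A : M → Eucl m →L[ℝ] Eucl m) (x₀ : M) (y : Eucl m) : Eucl m →L[ℝ] Eucl m :=
  chartDinv x₀ ((extChartAt (𝓡 m) x₀).symm y) ∘L A ((extChartAt (𝓡 m) x₀).symm y) ∘L chartD x₀ y

/-- The local expression of a vector field in the chart at `x₀`. -/
def locVec (X : M → Eucl m) (x₀ : M) (y : Eucl m) : Eucl m :=
  chartDinv x₀ ((extChartAt (𝓡 m) x₀).symm y) (X ((extChartAt (𝓡 m) x₀).symm y))

/-- The local expression of a field of covectors in the chart at `x₀`. -/
def locCo (η : M → Eucl m →L[ℝ] ℝ) (x₀ : M) (y : Eucl m) : Eucl m →L[ℝ] ℝ :=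
  η ((extChartAt (𝓡 m) x₀).symm y) ∘L chartD x₀ y

/-- The local expression of a field of bilinear forms in the chart at `x₀`. -/
def locBil (b : M → Eucl m →L[ℝ] Eucl m →L[ℝ] ℝ) (x₀ : M) (y : Eucl m) :
    Eucl m →L[ℝ] Eucl m →L[ℝ] ℝ :=
  (b ((extChartAt (𝓡 m) x₀).symm y)).bilinearComp (chartD x₀ y) (chartD x₀ y)

variable [IsManifold (𝓡 m) ∞ M] {A : M → Eucl m →L[ℝ] Eucl m} {X Y : M → Eucl m}
  {η : M → Eucl m →L[ℝ] ℝ} {b : M → Eucl m →L[ℝ] Eucl m →L[ℝ] ℝ}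

theorem locEnd_self (x : M) : locEnd A x (extChartAt (𝓡 m) x x) = A x := by
  rw [locEnd, chartD_self, extChartAt_to_inv, chartDinv_self]
  rfl

theorem locVec_self (x : M) : locVec X x (extChartAt (𝓡 m) x x) = X x := by
  rw [locVec, extChartAt_to_inv, chartDinv_self]
  rfl

theorem locCo_self (x : M) : locCo η x (extChartAt (𝓡 m) x x) = η x := by
  rw [locCo, chartD_self, extChartAt_to_inv]
  rfl

theorem contDiffAt_congr {V F : Type*} [NormedAddCommGroup V] [NormedSpace ℝ V]
    [NormedAddCommGroup F] [NormedSpace ℝ F] {f g : V → F} {x : V} (h : f =ᶠ[nhds x] g) :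
    ContDiffAt ℝ ∞ f x ↔ ContDiffAt ℝ ∞ g x :=
  ⟨fun hf => hf.congr_of_eventuallyEq h.symm, fun hg => hg.congr_of_eventuallyEq h⟩

theorem contMDiffAt_iff_chart {F : Type*} [NormedAddCommGroup F] [NormedSpace ℝ F] {f : M → F}
    {x : M} : ContMDiffAt (𝓡 m) 𝓘(ℝ, F) ∞ f x ↔
      ContDiffAt ℝ ∞ (fun y => f ((extChartAt (𝓡 m) x).symm y)) (extChartAt (𝓡 m) x x) := by
  rw [contMDiffAt_iff_source_of_mem_source (mem_chart_source _ x)]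
  simp only [modelWithCornersSelf_coe, Set.range_id, contMDiffWithinAt_univ,
    contMDiffAt_iff_contDiffAt]
  rfl

/-- Together with `symmL_eq`, this translates smoothness of sections, phrased through bundle
trivializations, into smoothness of the local expressions. -/
theorem continuousLinearMapAt_eq {x : M} {y : Eucl m} (hy : y ∈ (extChartAt (𝓡 m) x).target)
    (v : Eucl m) : (trivializationAt (Eucl m) (TangentSpace (𝓡 m)) x).continuousLinearMapAt ℝ
      ((extChartAt (𝓡 m) x).symm y) v = chartDinv x ((extChartAt (𝓡 m) x).symm y) v := by
  have := isManifold_one (m := m) (M := M)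
  have hs : (extChartAt (𝓡 m) x).symm y ∈ (chartAt (Eucl m) x).source := by
    simpa using (extChartAt (𝓡 m) x).map_target hy
  have h := TangentBundle.continuousLinearMapAt_trivializationAt (𝕜 := ℝ) (I := 𝓡 m) hs
  exact congrArg (fun L : Eucl m →L[ℝ] Eucl m => L v) h

theorem symmL_eq {x : M} {y : Eucl m} (hy : y ∈ (extChartAt (𝓡 m) x).target)
    (v : Eucl m) : (trivializationAt (Eucl m) (TangentSpace (𝓡 m)) x).symmL ℝ
      ((extChartAt (𝓡 m) x).symm y) v = chartD x y v := by
  have := isManifold_one (m := m) (M := M)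
  have hs : (extChartAt (𝓡 m) x).symm y ∈ (chartAt (Eucl m) x).source := by
    simpa using (extChartAt (𝓡 m) x).map_target hy
  have h := TangentBundle.symmL_trivializationAt (𝕜 := ℝ) (I := 𝓡 m) hs
  rw [(extChartAt (𝓡 m) x).right_inv hy] at h
  simp only [modelWithCornersSelf_coe, Set.range_id, mfderivWithin_univ] at h
  exact congrArg (fun L : Eucl m →L[ℝ] Eucl m => L v) h

theorem smoothEnd_iff :
    SmoothEnd (m := m) A ↔ ∀ x, ContDiffAt ℝ ∞ (locEnd A x) (extChartAt (𝓡 m) x x) := by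
  have := isManifold_one (m := m) (M := M)
  refine forall_congr' fun x => ?_
  rw [contMDiffAt_hom_bundle, contMDiffAt_iff_chart]
  refine (and_iff_right contMDiffAt_id).trans (contDiffAt_congr ?_)
  filter_upwards [extChartAt_target_mem_nhds (I := 𝓡 m) x] with y hy
  ext1 v
  refine (continuousLinearMapAt_eq hy _).trans ?_
  exact congrArg (fun w : Eucl m => chartDinv x ((extChartAt (𝓡 m) x).symm y)
    (A ((extChartAt (𝓡 m) x).symm y) w)) (symmL_eq hy v)

theorem smoothVFieldAt_iff {x : M} :
    SmoothVFieldAt (m := m) X x ↔ ContDiffAt ℝ ∞ (locVec X x) (extChartAt (𝓡 m) x x) := by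
  have := isManifold_one (m := m) (M := M)
  refine (Bundle.contMDiffAt_section (E := fun y : M => TangentSpace (𝓡 m) y) x).trans ?_
  rw [contMDiffAt_iff_chart]
  refine contDiffAt_congr ?_
  filter_upwards [extChartAt_target_mem_nhds (I := 𝓡 m) x] with y hy
  have hs : (extChartAt (𝓡 m) x).symm y ∈ (chartAt (Eucl m) x).source := by
    simpa using (extChartAt (𝓡 m) x).map_target hy
  refine Eq.trans ?_ (continuousLinearMapAt_eq hy _)
  exact (Bundle.Trivialization.continuousLinearMapAt_apply_of_mem (R := ℝ) _
    (by simpa using hs) _).symm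

theorem smoothBilin_iff :
    ContMDiff (𝓡 m) ((𝓡 m).prod 𝓘(ℝ, Eucl m →L[ℝ] Eucl m →L[ℝ] ℝ)) ∞
      (fun x => Bundle.TotalSpace.mk' (Eucl m →L[ℝ] Eucl m →L[ℝ] ℝ)
        (E := fun y : M => TangentSpace (𝓡 m) y →L[ℝ] TangentSpace (𝓡 m) y →L[ℝ] ℝ) x (b x)) ↔
    ∀ x, ContDiffAt ℝ ∞ (locBil b x) (extChartAt (𝓡 m) x x) := by
  have := isManifold_one (m := m) (M := M)
  refine forall_congr' fun x => ?_
  rw [contMDiffAt_hom_bundle, contMDiffAt_iff_chart]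
  refine (and_iff_right contMDiffAt_id).trans (contDiffAt_congr ?_)
  filter_upwards [extChartAt_target_mem_nhds (I := 𝓡 m) x] with y hy
  have hs : (extChartAt (𝓡 m) x).symm y ∈ (chartAt (Eucl m) x).source := by
    simpa using (extChartAt (𝓡 m) x).map_target hy
  ext v w
  refine (inCoordinates_apply_eq₂ (E₁ := fun y : M => TangentSpace (𝓡 m) y)
    (E₂ := fun y : M => TangentSpace (𝓡 m) y) (E₃ := Bundle.Trivial M ℝ)
    (by simpa using hs) (by simpa using hs) (by simp)).trans ?_
  have h2 : ∀ v : Eucl m, (trivializationAt (Eucl m) (TangentSpace (𝓡 m)) x).symm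
      ((extChartAt (𝓡 m) x).symm y) v = chartD x y v :=
    fun v => (Bundle.Trivialization.symmL_apply (R := ℝ) _
      (by simpa using hs) _).symm.trans (symmL_eq hy v)
  refine Eq.trans ?_ (congrArg₂ (fun p q => b ((extChartAt (𝓡 m) x).symm y) p q) (h2 v) (h2 w))
  simp
  rfl

/-- The Lie bracket of vector fields, with values in the model space. -/
def bracket (X Y : M → Eucl m) (x : M) : Eucl m :=
  VectorField.mlieBracket (M := M) (𝓡 m) X Y x

theorem bracket_eq (x : M) :
    bracket X Y x =
      fderiv ℝ (locVec Y x) (extChartAt (𝓡 m) x x) (X x) -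
        fderiv ℝ (locVec X x) (extChartAt (𝓡 m) x x) (Y x) := by
  have := isManifold_one (m := m) (M := M)
  -- Pulling back by the inverse chart means applying the inverse of its derivative, which is
  -- `chartDinv`. Agreement near the base point suffices, since the bracket is local.
  have key : ∀ X : M → Eucl m,
      VectorField.mpullbackWithin 𝓘(ℝ, Eucl m) (𝓡 m) (extChartAt (𝓡 m) x).symm X
        (Set.range (𝓡 m)) =ᶠ[nhds (extChartAt (𝓡 m) x x)] locVec X x := by
    intro X
    filter_upwards [extChartAt_target_mem_nhds (I := 𝓡 m) x] with y hy
    refine ((isInvertible_mfderivWithin_extChartAt_symm hy).inverse_apply_eq).2 ?_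
    have h := mfderivWithin_extChartAt_symm_comp_mfderiv_extChartAt (I := 𝓡 m) hy
    exact (congrArg (fun L : Eucl m →L[ℝ] Eucl m =>
      L (X ((extChartAt (𝓡 m) x).symm y))) h).symm
  have h1 : bracket X Y x =
      VectorField.lieBracket ℝ (locVec X x) (locVec Y x) (extChartAt (𝓡 m) x x) := by
    rw [← (key X).lieBracket_vectorField_eq (key Y)]
    refine (VectorField.mlieBracketWithin_apply (I := 𝓡 m) (M := M) (V := X) (W := Y)
      (s := Set.univ)).trans ?_
    have h2 : (mfderiv (𝓡 m) 𝓘(ℝ, Eucl m) (extChartAt (𝓡 m) x) x).inverse =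
        ContinuousLinearMap.id ℝ (Eucl m) := by
      rw [mfderiv_extChartAt_self]
      exact ContinuousLinearMap.inverse_id
    refine (congrArg (fun L : Eucl m →L[ℝ] Eucl m => L _) h2).trans ?_
    refine Eq.trans ?_ (congrFun (VectorField.lieBracketWithin_univ (𝕜 := ℝ)) _)
    change VectorField.lieBracketWithin _ _ _ _ _ = _
    congr 1
    simp
  rw [h1, VectorField.lieBracket, locVec_self, locVec_self]

theorem locVec_apply (x : M) :
    locVec (fun z => A z (X z)) x =ᶠ[nhds (extChartAt (𝓡 m) x x)]
      fun y => locEnd A x y (locVec X x y) := by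
  filter_upwards [extChartAt_target_mem_nhds (I := 𝓡 m) x] with y hy
  simp only [locVec, locEnd, ContinuousLinearMap.comp_apply]
  rw [chartD_chartDinv hy]

/-- The algebraic expression of the Nijenhuis tensor in terms of an endomorphism `a` and its
derivative `D`. -/
def nijAlg {V : Type*} [NormedAddCommGroup V] [NormedSpace ℝ V] (a : V →L[ℝ] V)
    (D : V →L[ℝ] V →L[ℝ] V) (u v : V) : V :=
  D (a u) v - D (a v) u + a (D v u) - a (D u v)

/-- The first derivatives of `X` and `Y` cancel in the four brackets; only the derivative of `A`
survives. This is the tensoriality of the Nijenhuis expression. -/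
theorem nijenhuis_eq (hA : SmoothEnd (m := m) A) {x : M}
    (hX : SmoothVFieldAt (m := m) X x) (hY : SmoothVFieldAt (m := m) Y x) :
    (nijenhuis (m := m) A X Y x : Eucl m) =
      nijAlg (A x) (fderiv ℝ (locEnd A x) (extChartAt (𝓡 m) x x)) (X x) (Y x) := by
  have dA := (smoothEnd_iff.1 hA x).differentiableAt (by simp)
  have hd : ∀ Z : M → Eucl m, SmoothVFieldAt (m := m) Z x → ∀ v : Eucl m,
      fderiv ℝ (locVec (fun z => A z (Z z)) x) (extChartAt (𝓡 m) x x) v =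
        fderiv ℝ (locEnd A x) (extChartAt (𝓡 m) x x) v (Z x) +
          A x (fderiv ℝ (locVec Z x) (extChartAt (𝓡 m) x x) v) := by
    intro Z hZ v
    have dZ := (smoothVFieldAt_iff.1 hZ).differentiableAt (by simp)
    rw [(locVec_apply x).fderiv_eq, fderiv_clm_apply dA dZ, locVec_self, locEnd_self]
    simp [add_comm]
  have e1 := hd X hX
  have e2 := hd Y hY
  have h0 := bracket_eq (X := X) (Y := Y) x
  have h1 := bracket_eq (X := fun z => A z (X z)) (Y := fun z => A z (Y z)) x
  have h2 := bracket_eq (X := fun z => A z (X z)) (Y := Y) x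
  have h3 := bracket_eq (X := X) (Y := fun z => A z (Y z)) x
  rw [e1, e2] at h1
  rw [e1] at h2
  rw [e2] at h3
  have hn : (nijenhuis (m := m) A X Y x : Eucl m) =
      A x (A x (bracket X Y x)) + bracket (fun y => A y (X y)) (fun y => A y (Y y)) x
        - A x (bracket (fun y => A y (X y)) Y x) - A x (bracket X (fun y => A y (Y y)) x) := rfl
  refine hn.trans ?_
  rw [h0, h1, h2, h3, nijAlg]
  simp only [map_sub, map_add]
  abel

/-- Every tangent vector at `x` is the value of a field that is constant in the chart at `x`. Such a
field is smooth at `x`, which is all that the definition of normality asks for. -/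
theorem isNormal_pointwise (hA : SmoothEnd (m := m) A) {ξ : M → Eucl m}
    (h : IsNormal (m := m) A ξ η) (x : M) (a b : Eucl m) :
    nijAlg (A x) (fderiv ℝ (locEnd A x) (extChartAt (𝓡 m) x x)) a b +
      extD (m := m) (oneForm η) x ![a, b] • ξ x = 0 := by
  have hconst : ∀ c : Eucl m, ∃ X : M → Eucl m, SmoothVFieldAt (m := m) X x ∧ X x = c := by
    intro c
    let X : M → Eucl m := fun z => chartD x (extChartAt (𝓡 m) x z) c
    refine ⟨X, smoothVFieldAt_iff.2 ?_, ?_⟩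
    · refine (contDiffAt_congr ?_).2 (contDiffAt_const (c := c))
      filter_upwards [extChartAt_target_mem_nhds (I := 𝓡 m) x] with y hy
      simp only [locVec, X]
      rw [(extChartAt (𝓡 m) x).right_inv hy]
      exact chartDinv_chartD hy c
    · simp only [X]
      rw [chartD_self]
      rfl
  obtain ⟨X, hX, rfl⟩ := hconst a
  obtain ⟨Y, hY, rfl⟩ := hconst b
  rw [← nijenhuis_eq hA hX hY]
  exact h X Y x hX hY

theorem isComplex_pointwise (hA : SmoothEnd (m := m) A)
    (h : ∀ x u v, nijAlg (A x) (fderiv ℝ (locEnd A x) (extChartAt (𝓡 m) x x)) u v = 0)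
    (hsq : ∀ x v, A x (A x v) = -v) : IsComplexStructure (m := m) A where
  smooth := hA
  sq := hsq
  integrable _ _ x hX hY := (nijenhuis_eq hA hX hY).trans (h x _ _)

theorem chartForm_oneForm (x : M) (y : Eucl m) :
    chartForm (m := m) (oneForm η) x y =
      ContinuousAlternatingMap.ofSubsingleton ℝ (Eucl m) ℝ (0 : Fin 1) (locCo η x y) := by
  ext v
  rfl

theorem contDiffAt_clm {V E F : Type*} [NormedAddCommGroup V] [NormedSpace ℝ V]
    [NormedAddCommGroup E] [NormedSpace ℝ E] [FiniteDimensional ℝ E]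
    [NormedAddCommGroup F] [NormedSpace ℝ F] {f : V → E →L[ℝ] F} {x : V}
    (h : ∀ v, ContDiffAt ℝ ∞ (fun y => f y v) x) : ContDiffAt ℝ ∞ f x := by
  let d := Module.finrank ℝ E
  let e₁ : E ≃L[ℝ] Fin d → ℝ :=
    ContinuousLinearEquiv.ofFinrankEq (Module.finrank_fin_fun ℝ).symm
  let e₂ := (e₁.arrowCongr (1 : F ≃L[ℝ] F)).trans (ContinuousLinearEquiv.piRing (Fin d))
  rw [← Function.id_comp f, ← e₂.symm_comp_self]
  exact e₂.symm.contDiff.contDiffAt.comp x (contDiffAt_pi.2 fun i => h _)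

theorem contDiffAt_locCo (h : FormSmooth (m := m) (oneForm η)) (x : M) :
    ContDiffAt ℝ ∞ (locCo η x) (extChartAt (𝓡 m) x x) := by
  refine contDiffAt_clm fun v => ?_
  exact ContDiffAt.alt_apply (w := fun _ _ => v) (h x) fun _ => contDiffAt_const

theorem extD_oneForm (h : FormSmooth (m := m) (oneForm η)) (x : M)
    (a b : Eucl m) : extD (m := m) (oneForm η) x ![a, b] =
      fderiv ℝ (locCo η x) (extChartAt (𝓡 m) x x) a b -
        fderiv ℝ (locCo η x) (extChartAt (𝓡 m) x x) b a := by
  have hd := (contDiffAt_locCo h x).differentiableAt (by simp)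
  have hc : ∀ v w : Eucl m, fderiv ℝ (fun y => locCo η x y v) (extChartAt (𝓡 m) x x) w =
      fderiv ℝ (locCo η x) (extChartAt (𝓡 m) x x) w v := by
    intro v w
    rw [fderiv_clm_apply hd (differentiableAt_const v)]
    simp
  rw [extD_eq]
  refine (extDeriv_apply (h.differentiableAt x) _).trans ?_
  have h0 := hc b a
  have h1 := hc a b
  refine (Fin.sum_univ_two _).trans ?_
  rw [← h0, ← h1]
  simp [chartForm_oneForm, Fin.removeNth, sub_eq_add_neg]

end Fields

/-! ### Evaluation of wedge products -/

section Wedge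

open Equiv

/-- A permutation is determined by the image `p` of `0` and a permutation of the remaining indices;
the transposition of `0` and `p` contributes the sign. This recursion produces the explicit sums
over three and four indices. -/
theorem sum_perm_succ {n : ℕ} (G : Perm (Fin (n + 1)) → ℝ) :
    ∑ σ : Perm (Fin (n + 1)), Perm.sign σ • G σ =
      ∑ p : Fin (n + 1), (if p = 0 then 1 else -1 : ℝ) *
        ∑ e : Perm (Fin n), Perm.sign e • G (Perm.decomposeFin.symm (p, e)) := by
  rw [← Perm.decomposeFin.symm.sum_comp, Fintype.sum_prod_type]
  refine Finset.sum_congr rfl fun p _ => ?_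
  rw [Finset.mul_sum]
  refine Finset.sum_congr rfl fun e _ => ?_
  rw [Perm.decomposeFin.symm_sign]
  split_ifs <;> simp [Units.smul_def]

theorem sum_perm_two (F : Fin 2 → Fin 2 → ℝ) :
    ∑ σ : Perm (Fin 2), Perm.sign σ • F (σ 0) (σ 1) = F 0 1 - F 1 0 := by
  rw [← Perm.decomposeFin.symm.sum_comp]
  simp [Fintype.sum_prod_type, Fin.sum_univ_succ, Perm.decomposeFin.symm_sign, sub_eq_add_neg]

theorem sum_perm_three (F : Fin 3 → Fin 3 → Fin 3 → ℝ) :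
    ∑ σ : Perm (Fin 3), Perm.sign σ • F (σ 0) (σ 1) (σ 2) =
      F 0 1 2 - F 0 2 1 - F 1 0 2 + F 1 2 0 - F 2 1 0 + F 2 0 1 := by
  rw [sum_perm_succ]
  have h : ∀ (p : Fin 3) (e : Perm (Fin 2)), F (Perm.decomposeFin.symm (p, e) 0)
      (Perm.decomposeFin.symm (p, e) 1) (Perm.decomposeFin.symm (p, e) 2) =
      F p (swap 0 p (e 0).succ) (swap 0 p (e 1).succ) := by
    intro p e
    rw [Perm.decomposeFin_symm_apply_zero]
    exact congrArg₂ (F p) (Perm.decomposeFin_symm_apply_succ e p 0)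
      (Perm.decomposeFin_symm_apply_succ e p 1)
  have h2 := fun p => sum_perm_two fun i j => F p (swap 0 p i.succ) (swap 0 p j.succ)
  simp only [h, h2]
  refine (Fin.sum_univ_three _).trans ?_
  have s : (swap (0 : Fin 3) 1 1 = 0 ∧ swap (0 : Fin 3) 1 2 = 2) ∧
    (swap (0 : Fin 3) 2 1 = 1 ∧ swap (0 : Fin 3) 2 2 = 0) := by decide
  simp [s]
  ring

theorem sum_perm_four (F : Fin 4 → Fin 4 → Fin 4 → Fin 4 → ℝ) :
    ∑ σ : Perm (Fin 4), Perm.sign σ • F (σ 0) (σ 1) (σ 2) (σ 3) =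
      F 0 1 2 3 - F 0 1 3 2 - F 0 2 1 3 + F 0 2 3 1 - F 0 3 2 1 + F 0 3 1 2
      - (F 1 0 2 3 - F 1 0 3 2 - F 1 2 0 3 + F 1 2 3 0 - F 1 3 2 0 + F 1 3 0 2)
      - (F 2 1 0 3 - F 2 1 3 0 - F 2 0 1 3 + F 2 0 3 1 - F 2 3 0 1 + F 2 3 1 0)
      - (F 3 1 2 0 - F 3 1 0 2 - F 3 2 1 0 + F 3 2 0 1 - F 3 0 2 1 + F 3 0 1 2) := by
  rw [sum_perm_succ]
  have h : ∀ (p : Fin 4) (e : Perm (Fin 3)), F (Perm.decomposeFin.symm (p, e) 0)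
      (Perm.decomposeFin.symm (p, e) 1) (Perm.decomposeFin.symm (p, e) 2)
      (Perm.decomposeFin.symm (p, e) 3) =
      F p (swap 0 p (e 0).succ) (swap 0 p (e 1).succ) (swap 0 p (e 2).succ) := by
    intro p e
    have h1 := Perm.decomposeFin_symm_apply_succ e p 0
    have h2 := Perm.decomposeFin_symm_apply_succ e p 1
    have h3 := Perm.decomposeFin_symm_apply_succ e p 2
    rw [← h1, ← h2, ← h3, Perm.decomposeFin_symm_apply_zero]
    rfl
  have h2 := fun p => sum_perm_three fun i j k =>
    F p (swap 0 p i.succ) (swap 0 p j.succ) (swap 0 p k.succ)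
  simp only [h, h2]
  refine (Fin.sum_univ_four _).trans ?_
  have s : (swap (0 : Fin 4) 1 1 = 0 ∧ swap (0 : Fin 4) 1 2 = 2 ∧ swap (0 : Fin 4) 1 3 = 3) ∧
    (swap (0 : Fin 4) 2 1 = 1 ∧ swap (0 : Fin 4) 2 2 = 0 ∧ swap (0 : Fin 4) 2 3 = 3) ∧
    (swap (0 : Fin 4) 3 1 = 1 ∧ swap (0 : Fin 4) 3 2 = 2 ∧ swap (0 : Fin 4) 3 3 = 0) := by decide
  have s2 : (2 : Fin 3).succ = (3 : Fin 4) := rfl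
  simp [s, s2]
  ring

variable {V : Type*} [AddCommGroup V] [Module ℝ V] [TopologicalSpace V]

theorem alt_swap (a : V [⋀^Fin 2]→L[ℝ] ℝ) (u v : V) : a ![u, v] = -a ![v, u] := by
  have h := a.toAlternatingMap.map_swap ![v, u] (i := 0) (j := 1) (by decide)
  have h1 : (![v, u] : Fin 2 → V) ∘ swap 0 1 = ![u, v] := by
    funext i; fin_cases i <;> rfl
  rw [h1] at h
  exact h

theorem wedgeAlt_apply {k l : ℕ} (a : V [⋀^Fin k]→L[ℝ] ℝ) (b : V [⋀^Fin l]→L[ℝ] ℝ)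
    (v : Fin (k + l) → V) : wedgeAlt a b v = (k.factorial * l.factorial : ℝ)⁻¹ *
      ∑ σ : Perm (Fin (k + l)), Perm.sign σ • (a (fun i => v (σ (Fin.castAdd l i))) *
        b (fun i => v (σ (Fin.natAdd k i)))) := by
  change (k.factorial * l.factorial : ℝ)⁻¹ * (mulAlt a b).alternatization v = _
  rw [ContinuousMultilinearMap.alternatization_apply_apply]
  rfl

theorem vec_one {α : Type*} (v : Fin 1 → α) : v = ![v 0] := by
  funext i; fin_cases i; rfl

theorem vec_two {α : Type*} (v : Fin 2 → α) : v = ![v 0, v 1] := by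
  funext i; fin_cases i <;> rfl

theorem vec_three {α : Type*} (v : Fin 3 → α) : v = ![v 0, v 1, v 2] := by
  funext i; fin_cases i <;> rfl

theorem vec_four {α : Type*} (v : Fin 4 → α) : v = ![v 0, v 1, v 2, v 3] := by
  funext i; fin_cases i <;> rfl

theorem wedgeAlt_one_one (a b : V [⋀^Fin 1]→L[ℝ] ℝ) (u v : V) :
    wedgeAlt a b ![u, v] = a ![u] * b ![v] - a ![v] * b ![u] := by
  let w : Fin 2 → V := ![u, v]
  have h := sum_perm_two fun i j => a ![w i] * b ![w j]
  refine (wedgeAlt_apply a b _).trans ?_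
  have e : ∀ σ : Perm (Fin 2), a (fun i => w (σ (Fin.castAdd 1 i))) *
        b (fun i => w (σ (Fin.natAdd 1 i))) = a ![w (σ 0)] * b ![w (σ 1)] := by
    intro σ
    rw [vec_one (fun i => w (σ (Fin.castAdd 1 i))), vec_one (fun i => w (σ (Fin.natAdd 1 i)))]
    rfl
  simp only [w] at e h
  erw [Finset.sum_congr rfl fun σ _ => congrArg (Perm.sign σ • ·) (e σ), h]
  simp

/-- The six permutations pair up by the skew symmetry of `b`, and the resulting factor two cancels
the factorials. With such explicit formulas the later identities between forms reduce to ring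
identities. -/
theorem wedgeAlt_one_two (a : V [⋀^Fin 1]→L[ℝ] ℝ) (b : V [⋀^Fin 2]→L[ℝ] ℝ) (u v w : V) :
    wedgeAlt a b ![u, v, w] =
      a ![u] * b ![v, w] - a ![v] * b ![u, w] + a ![w] * b ![u, v] := by
  let x : Fin 3 → V := ![u, v, w]
  have h := sum_perm_three fun i j k => a ![x i] * b ![x j, x k]
  refine (wedgeAlt_apply a b _).trans ?_
  have e : ∀ σ : Perm (Fin 3), a (fun i => x (σ (Fin.castAdd 2 i))) *
        b (fun i => x (σ (Fin.natAdd 1 i))) = a ![x (σ 0)] * b ![x (σ 1), x (σ 2)] := by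
    intro σ
    rw [vec_one (fun i => x (σ (Fin.castAdd 2 i))), vec_two (fun i => x (σ (Fin.natAdd 1 i)))]
    rfl
  erw [Finset.sum_congr rfl fun σ _ => congrArg (Perm.sign σ • ·) (e σ), h]
  simp only [x, Matrix.cons_val]
  rw [alt_swap b w v, alt_swap b w u, alt_swap b v u]
  norm_num
  ring

theorem wedgeAlt_two_one (a : V [⋀^Fin 2]→L[ℝ] ℝ) (b : V [⋀^Fin 1]→L[ℝ] ℝ) (u v w : V) :
    wedgeAlt a b ![u, v, w] =
      a ![u, v] * b ![w] - a ![u, w] * b ![v] + a ![v, w] * b ![u] := by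
  let x : Fin 3 → V := ![u, v, w]
  have h := sum_perm_three fun i j k => a ![x i, x j] * b ![x k]
  refine (wedgeAlt_apply a b _).trans ?_
  have e : ∀ σ : Perm (Fin 3), a (fun i => x (σ (Fin.castAdd 1 i))) *
        b (fun i => x (σ (Fin.natAdd 2 i))) = a ![x (σ 0), x (σ 1)] * b ![x (σ 2)] := by
    intro σ
    rw [vec_two (fun i => x (σ (Fin.castAdd 1 i))), vec_one (fun i => x (σ (Fin.natAdd 2 i)))]
    rfl
  erw [Finset.sum_congr rfl fun σ _ => congrArg (Perm.sign σ • ·) (e σ), h]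
  simp only [x, Matrix.cons_val]
  rw [alt_swap a w v, alt_swap a w u, alt_swap a v u]
  norm_num
  ring

theorem wedgeAlt_two_two (a b : V [⋀^Fin 2]→L[ℝ] ℝ) (u v w z : V) :
    wedgeAlt a b ![u, v, w, z] =
      a ![u, v] * b ![w, z] - a ![u, w] * b ![v, z] + a ![u, z] * b ![v, w]
      + a ![v, w] * b ![u, z] - a ![v, z] * b ![u, w] + a ![w, z] * b ![u, v] := by
  let x : Fin 4 → V := ![u, v, w, z]
  have h := sum_perm_four fun i j k l => a ![x i, x j] * b ![x k, x l]
  refine (wedgeAlt_apply a b _).trans ?_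
  have e : ∀ σ : Perm (Fin 4), a (fun i => x (σ (Fin.castAdd 2 i))) *
        b (fun i => x (σ (Fin.natAdd 2 i))) =
        a ![x (σ 0), x (σ 1)] * b ![x (σ 2), x (σ 3)] := by
    intro σ
    rw [vec_two (fun i => x (σ (Fin.castAdd 2 i))), vec_two (fun i => x (σ (Fin.natAdd 2 i)))]
    rfl
  erw [Finset.sum_congr rfl fun σ _ => congrArg (Perm.sign σ • ·) (e σ), h]
  simp only [x, Matrix.cons_val]
  rw [alt_swap a v u, alt_swap a w u, alt_swap a z u, alt_swap a w v, alt_swap a z v,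
    alt_swap a z w, alt_swap b v u, alt_swap b w u, alt_swap b z u, alt_swap b w v,
    alt_swap b z v, alt_swap b z w]
  norm_num
  ring

end Wedge

/-! ### The exterior derivative of wedge products -/

section Leibniz

variable {m : ℕ}

theorem extDeriv_apply_two {a : Eucl m → Eucl m [⋀^Fin 1]→L[ℝ] ℝ} {x : Eucl m}
    (h : DifferentiableAt ℝ a x) (u v : Eucl m) :
    extDeriv a x ![u, v] =
      fderiv ℝ (fun y => a y ![v]) x u - fderiv ℝ (fun y => a y ![u]) x v := by
  rw [extDeriv_apply h, Fin.sum_univ_two, vec_one (Fin.removeNth 0 ![u, v]),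
    vec_one (Fin.removeNth 1 ![u, v])]
  simp [Fin.removeNth, sub_eq_add_neg]

theorem extDeriv_apply_three {a : Eucl m → Eucl m [⋀^Fin 2]→L[ℝ] ℝ} {x : Eucl m}
    (h : DifferentiableAt ℝ a x) (u v w : Eucl m) :
    extDeriv a x ![u, v, w] =
      fderiv ℝ (fun y => a y ![v, w]) x u - fderiv ℝ (fun y => a y ![u, w]) x v
        + fderiv ℝ (fun y => a y ![u, v]) x w := by
  have h0 : Fin.removeNth 0 ![u, v, w] = ![v, w] := vec_two _
  have h1 : Fin.removeNth 1 ![u, v, w] = ![u, w] := vec_two _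
  have h2 : Fin.removeNth 2 ![u, v, w] = ![u, v] := vec_two _
  rw [extDeriv_apply h, Fin.sum_univ_three, h0, h1, h2]
  simp [sub_eq_add_neg]

theorem extDeriv_apply_four {a : Eucl m → Eucl m [⋀^Fin 3]→L[ℝ] ℝ} {x : Eucl m}
    (h : DifferentiableAt ℝ a x) (u v w z : Eucl m) :
    extDeriv a x ![u, v, w, z] =
      fderiv ℝ (fun y => a y ![v, w, z]) x u - fderiv ℝ (fun y => a y ![u, w, z]) x v
        + fderiv ℝ (fun y => a y ![u, v, z]) x w - fderiv ℝ (fun y => a y ![u, v, w]) x z := by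
  have h0 : Fin.removeNth 0 ![u, v, w, z] = ![v, w, z] := vec_three _
  have h1 : Fin.removeNth 1 ![u, v, w, z] = ![u, w, z] := vec_three _
  have h2 : Fin.removeNth 2 ![u, v, w, z] = ![u, v, z] := vec_three _
  have h3 : Fin.removeNth 3 ![u, v, w, z] = ![u, v, w] := vec_three _
  rw [extDeriv_apply h, Fin.sum_univ_four, h0, h1, h2, h3]
  simp [sub_eq_add_neg, pow_succ]

theorem differentiableAt_alt_apply {k : ℕ} {a : Eucl m → Eucl m [⋀^Fin k]→L[ℝ] ℝ}
    {x : Eucl m} (h : DifferentiableAt ℝ a x) (v : Fin k → Eucl m) :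
    DifferentiableAt ℝ (fun y => a y v) x :=
  (ContinuousAlternatingMap.apply ℝ (Eucl m) ℝ v).differentiableAt.comp x h

theorem contDiffAt_wedgeAlt {k l : ℕ} {a : Eucl m → Eucl m [⋀^Fin k]→L[ℝ] ℝ}
    {b : Eucl m → Eucl m [⋀^Fin l]→L[ℝ] ℝ} {x : Eucl m} (ha : ContDiffAt ℝ ∞ a x)
    (hb : ContDiffAt ℝ ∞ b x) : ContDiffAt ℝ ∞ (fun y => wedgeAlt (a y) (b y)) x := by
  refine contDiffAt_alt fun v => ?_
  simp only [wedgeAlt_apply]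
  refine contDiffAt_const.mul (ContDiffAt.sum fun σ _ => ContDiffAt.const_smul _ ?_)
  exact (ContDiffAt.alt_apply (w := fun _ i => v (σ (Fin.castAdd l i))) ha
    fun _ => contDiffAt_const).mul (ContDiffAt.alt_apply
      (w := fun _ i => v (σ (Fin.natAdd k i))) hb fun _ => contDiffAt_const)

/-- This is `d(a ∧ b) = da ∧ b - a ∧ db`, from the product rule for each directional derivative in
the alternating sum. The degrees `(1, 1)` and `(1, 2)` are those of `π^*η ∧ θ` in the fundamental
form and of `θ ∧ π^*(C - Ω)` in the torsion. -/
theorem extDeriv_wedge_one_one {a b : Eucl m → Eucl m [⋀^Fin 1]→L[ℝ] ℝ} {x : Eucl m}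
    (ha : ContDiffAt ℝ ∞ a x) (hb : ContDiffAt ℝ ∞ b x) (u v w : Eucl m) :
    extDeriv (fun y => wedgeAlt (a y) (b y)) x ![u, v, w] =
      extDeriv a x ![u, v] * b x ![w] - extDeriv a x ![u, w] * b x ![v]
        + extDeriv a x ![v, w] * b x ![u]
      - (a x ![u] * extDeriv b x ![v, w] - a x ![v] * extDeriv b x ![u, w]
        + a x ![w] * extDeriv b x ![u, v]) := by
  have da := ha.differentiableAt (by simp)
  have db := hb.differentiableAt (by simp)
  have hd : ∀ p q, fderiv ℝ (fun y => wedgeAlt (a y) (b y) ![p, q]) x = _ := fun p q => by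
    simp only [wedgeAlt_one_one]
    exact (((differentiableAt_alt_apply da ![p]).hasFDerivAt.mul (differentiableAt_alt_apply db ![q]).hasFDerivAt).sub
      ((differentiableAt_alt_apply da ![q]).hasFDerivAt.mul (differentiableAt_alt_apply db ![p]).hasFDerivAt)).fderiv
  rw [extDeriv_apply_three ((contDiffAt_wedgeAlt ha hb).differentiableAt (by simp)),
    hd, hd, hd]
  simp only [extDeriv_apply_two da, extDeriv_apply_two db, _root_.sub_apply,
    _root_.add_apply, _root_.smul_apply, smul_eq_mul]
  ring

theorem extDeriv_wedge_one_two {a : Eucl m → Eucl m [⋀^Fin 1]→L[ℝ] ℝ}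
    {b : Eucl m → Eucl m [⋀^Fin 2]→L[ℝ] ℝ} {x : Eucl m}
    (ha : ContDiffAt ℝ ∞ a x) (hb : ContDiffAt ℝ ∞ b x) (u v w z : Eucl m) :
    extDeriv (fun y => wedgeAlt (a y) (b y)) x ![u, v, w, z] =
      wedgeAlt (extDeriv a x) (b x) ![u, v, w, z]
      - (a x ![u] * extDeriv b x ![v, w, z] - a x ![v] * extDeriv b x ![u, w, z]
        + a x ![w] * extDeriv b x ![u, v, z] - a x ![z] * extDeriv b x ![u, v, w]) := by
  have da := ha.differentiableAt (by simp)
  have db := hb.differentiableAt (by simp)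
  have hd : ∀ p q r, fderiv ℝ (fun y => wedgeAlt (a y) (b y) ![p, q, r]) x = _ := fun p q r => by
    simp only [wedgeAlt_one_two]
    exact ((((differentiableAt_alt_apply da ![p]).hasFDerivAt.mul
      (differentiableAt_alt_apply db ![q, r]).hasFDerivAt).sub
      ((differentiableAt_alt_apply da ![q]).hasFDerivAt.mul (differentiableAt_alt_apply db ![p, r]).hasFDerivAt)).add
      ((differentiableAt_alt_apply da ![r]).hasFDerivAt.mul (differentiableAt_alt_apply db ![p, q]).hasFDerivAt)).fderiv
  have hw := extDeriv_apply_four (a := fun y => wedgeAlt (a y) (b y))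
    ((contDiffAt_wedgeAlt ha hb).differentiableAt (by simp)) u v w z
  rw [hd, hd, hd, hd] at hw
  refine hw.trans ?_
  refine Eq.trans ?_ (congrArg (· - _) (wedgeAlt_two_two (extDeriv a x) (b x) u v w z).symm)
  simp only [extDeriv_apply_two da, extDeriv_apply_three db, _root_.sub_apply,
    _root_.add_apply, _root_.smul_apply, smul_eq_mul]
  ring

end Leibniz

/-! ### Wedge products, interior products and endomorphism actions on smooth forms. -/

section FormOperations

variable {m : ℕ} {M : Type*} [TopologicalSpace M] [ChartedSpace (Eucl m) M]
  [IsManifold (𝓡 m) ∞ M]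

/-- The exterior derivative of a form with values in alternating forms on the model space. -/
def modelExtD {k : ℕ} (α : M → Eucl m [⋀^Fin k]→L[ℝ] ℝ) : M → Eucl m [⋀^Fin (k + 1)]→L[ℝ] ℝ :=
  extD (m := m) α

theorem modelExtD_eq {k : ℕ} (α : M → Eucl m [⋀^Fin k]→L[ℝ] ℝ) (x : M) :
    modelExtD α x = extDeriv (chartForm (m := m) α x) (extChartAt (𝓡 m) x x) :=
  extD_eq α x

theorem chartForm_wedge {k l : ℕ} (α : M → Eucl m [⋀^Fin k]→L[ℝ] ℝ)
    (β : M → Eucl m [⋀^Fin l]→L[ℝ] ℝ) (x : M) :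
    chartForm (m := m) (fun x => wedgeAlt (α x) (β x)) x =
      fun y => wedgeAlt (chartForm (m := m) α x y) (chartForm (m := m) β x y) := by
  funext y
  ext v
  rw [wedgeAlt_apply]
  exact wedgeAlt_apply (α ((extChartAt (𝓡 m) x).symm y)) (β ((extChartAt (𝓡 m) x).symm y)) _

theorem FormSmooth.wedge {k l : ℕ} {α : M → Eucl m [⋀^Fin k]→L[ℝ] ℝ}
    {β : M → Eucl m [⋀^Fin l]→L[ℝ] ℝ} (hα : FormSmooth (m := m) α) (hβ : FormSmooth (m := m) β) :
    FormSmooth (m := m) (fun x => wedgeAlt (α x) (β x)) := by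
  intro x
  rw [chartForm_wedge]
  exact contDiffAt_wedgeAlt (hα x) (hβ x)

theorem FormSmooth.neg {k : ℕ} {α : DForm (m := m) M k} (hα : FormSmooth α) :
    FormSmooth (-α) :=
  fun x => (hα x).neg

theorem FormSmooth.sub {k : ℕ} {α β : DForm (m := m) M k} (hα : FormSmooth α)
    (hβ : FormSmooth β) : FormSmooth (α - β) :=
  fun x => (hα x).sub (hβ x)

theorem extD_add {k : ℕ} {α β : DForm (m := m) M k} (hα : FormSmooth α) (hβ : FormSmooth β) :
    extD (α + β) = extD α + extD β := by
  funext x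
  rw [Pi.add_apply, extD_eq, extD_eq, extD_eq]
  exact extDeriv_add (hα.differentiableAt x) (hβ.differentiableAt x)

theorem extD_neg {k : ℕ} (α : DForm (m := m) M k) : extD (-α) = -extD α := by
  funext x
  rw [Pi.neg_apply, extD_eq, extD_eq]
  have h := extDeriv_smul (-1 : ℝ) (chartForm α x) (x := extChartAt (𝓡 m) x x)
  rw [neg_one_smul, neg_one_smul] at h
  exact h

theorem extD_sub {k : ℕ} {α β : DForm (m := m) M k} (hα : FormSmooth α) (hβ : FormSmooth β) :
    extD (α - β) = extD α - extD β := by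
  rw [sub_eq_add_neg, extD_add hα hβ.neg, extD_neg, sub_eq_add_neg]

theorem modelExtD_wedge_one_one {α β : M → Eucl m [⋀^Fin 1]→L[ℝ] ℝ}
    (hα : FormSmooth (m := m) α) (hβ : FormSmooth (m := m) β) (x : M) (u v w : Eucl m) :
    modelExtD (fun x => wedgeAlt (α x) (β x)) x ![u, v, w] =
      modelExtD α x ![u, v] * β x ![w] - modelExtD α x ![u, w] * β x ![v]
        + modelExtD α x ![v, w] * β x ![u]
      - (α x ![u] * modelExtD β x ![v, w] - α x ![v] * modelExtD β x ![u, w]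
        + α x ![w] * modelExtD β x ![u, v]) := by
  have ea : chartForm (m := m) α x (extChartAt (𝓡 m) x x) = α x := chartForm_self (m := m) α x
  have eb : chartForm (m := m) β x (extChartAt (𝓡 m) x x) = β x := chartForm_self (m := m) β x
  have h := extDeriv_wedge_one_one (hα x) (hβ x) u v w
  rw [← chartForm_wedge, ea, eb, ← modelExtD_eq, ← modelExtD_eq] at h
  rw [modelExtD_eq fun x => wedgeAlt (α x) (β x)]
  exact h

theorem modelExtD_wedge_one_two {α : M → Eucl m [⋀^Fin 1]→L[ℝ] ℝ}
    {β : M → Eucl m [⋀^Fin 2]→L[ℝ] ℝ}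
    (hα : FormSmooth (m := m) α) (hβ : FormSmooth (m := m) β) (x : M) (u v w z : Eucl m) :
    modelExtD (fun x => wedgeAlt (α x) (β x)) x ![u, v, w, z] =
      wedgeAlt (modelExtD α x) (β x) ![u, v, w, z]
      - (α x ![u] * modelExtD β x ![v, w, z] - α x ![v] * modelExtD β x ![u, w, z]
        + α x ![w] * modelExtD β x ![u, v, z]
        - α x ![z] * modelExtD β x ![u, v, w]) := by
  have ea : chartForm (m := m) α x (extChartAt (𝓡 m) x x) = α x := chartForm_self (m := m) α x
  have eb : chartForm (m := m) β x (extChartAt (𝓡 m) x x) = β x := chartForm_self (m := m) β x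
  have h := extDeriv_wedge_one_two (hα x) (hβ x) u v w z
  rw [← chartForm_wedge, ea, eb, ← modelExtD_eq, ← modelExtD_eq] at h
  rw [modelExtD_eq fun x => wedgeAlt (α x) (β x)]
  exact h

theorem FormSmooth.act {k : ℕ} {A : M → Eucl m →L[ℝ] Eucl m} (hA : SmoothEnd (m := m) A)
    {α : M → Eucl m [⋀^Fin k]→L[ℝ] ℝ} (hα : FormSmooth (m := m) α) :
    FormSmooth (m := m) (act (m := m) A α) := by
  intro x
  have h : ∀ᶠ y in nhds (extChartAt (𝓡 m) x x), ∀ v,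
      chartForm (m := m) (CircleHKT.act (m := m) A α) x y v =
        chartForm (m := m) α x y (fun j => locEnd A x y (v j)) := by
    filter_upwards [extChartAt_target_mem_nhds (I := 𝓡 m) x] with y hy v
    refine congrArg (α ((extChartAt (𝓡 m) x).symm y)) ?_
    funext j
    exact (chartD_chartDinv hy _).symm
  refine contDiffAt_alt fun v => (contDiffAt_congr (h.mono fun y hy => hy v)).2 ?_
  exact ContDiffAt.alt_apply (hα x) fun j => (smoothEnd_iff.1 hA x).clm_apply contDiffAt_const

theorem FormSmooth.contract {k : ℕ} {ξ : M → Eucl m} (hξ : ∀ x, SmoothVFieldAt (m := m) ξ x)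
    {α : M → Eucl m [⋀^Fin (k + 1)]→L[ℝ] ℝ} (hα : FormSmooth (m := m) α) :
    FormSmooth (m := m) (contract (m := m) ξ α) := by
  intro x
  have h : ∀ᶠ y in nhds (extChartAt (𝓡 m) x x), ∀ v : Fin k → Eucl m,
      chartForm (m := m) (CircleHKT.contract (m := m) ξ α) x y v =
        chartForm (m := m) α x y (Fin.cons (locVec ξ x y) v : Fin (k + 1) → Eucl m) := by
    filter_upwards [extChartAt_target_mem_nhds (I := 𝓡 m) x] with y hy v
    refine congrArg (α ((extChartAt (𝓡 m) x).symm y)) ?_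
    funext j
    refine Fin.cases ?_ (fun i => ?_) j
    · exact (chartD_chartDinv hy _).symm
    · rfl
  refine contDiffAt_alt fun v => (contDiffAt_congr (h.mono fun y hy => hy v)).2 ?_
  refine ContDiffAt.alt_apply (hα x) fun j => ?_
  refine Fin.cases ?_ (fun i => ?_) j
  · exact smoothVFieldAt_iff.1 (hξ x)
  · exact contDiffAt_const

theorem formSmooth_fundForm {b : M → Eucl m →L[ℝ] Eucl m →L[ℝ] ℝ}
    (hb : ∀ x, ContDiffAt ℝ ∞ (locBil b x) (extChartAt (𝓡 m) x x))
    {A : M → Eucl m →L[ℝ] Eucl m} (hA : SmoothEnd (m := m) A) :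
    FormSmooth (m := m) (fundForm (m := m) b A) := by
  intro x
  have h : ∀ᶠ y in nhds (extChartAt (𝓡 m) x x), ∀ v : Fin 2 → Eucl m,
      chartForm (m := m) (fundForm (m := m) b A) x y v =
        (1 / 2 : ℝ) * (locBil b x y (v 0) (locEnd A x y (v 1)) -
          locBil b x y (v 1) (locEnd A x y (v 0))) := by
    filter_upwards [extChartAt_target_mem_nhds (I := 𝓡 m) x] with y hy v
    simp only [locBil, locEnd, ContinuousLinearMap.bilinearComp_apply,
      ContinuousLinearMap.comp_apply, chartD_chartDinv hy]
    rfl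
  refine contDiffAt_alt fun v => (contDiffAt_congr (h.mono fun y hy => hy v)).2 ?_
  have hE := fun v : Eucl m => (smoothEnd_iff.1 hA x).clm_apply (contDiffAt_const (c := v))
  have hB := fun v : Eucl m => (hb x).clm_apply (contDiffAt_const (c := v))
  exact contDiffAt_const.mul (((hB _).clm_apply (hE _)).sub ((hB _).clm_apply (hE _)))

end FormOperations

/-! ### The algebra of normality -/

section Algebra

variable {E E' : Type*} [NormedAddCommGroup E] [NormedSpace ℝ E] [NormedAddCommGroup E']
  [NormedSpace ℝ E']

/-- The values and first derivatives at a point of a normal almost contact structure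
`(a, ξ, η)`, with `D`, `Dξ`, `Dη` the derivatives. -/
structure NormalJet (a : E →L[ℝ] E) (ξ : E) (η : E →L[ℝ] ℝ) (D : E →L[ℝ] E →L[ℝ] E)
    (Dξ : E →L[ℝ] E) (Dη : E →L[ℝ] E →L[ℝ] ℝ) : Prop where
  sq : ∀ v, a (a v) = -v + η v • ξ
  eta_xi : η ξ = 1
  apply_xi : a ξ = 0
  eta_apply : ∀ v, η (a v) = 0
  deriv_apply_xi : ∀ v, D v ξ + a (Dξ v) = 0
  deriv_eta_apply : ∀ v w, Dη v (a w) + η (D v w) = 0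
  deriv_eta_xi : ∀ v, Dη v ξ + η (Dξ v) = 0
  normal : ∀ u v, nijAlg a D u v + (Dη u v - Dη v u) • ξ = 0

variable {a : E →L[ℝ] E} {ξ : E} {η : E →L[ℝ] ℝ} {D : E →L[ℝ] E →L[ℝ] E} {Dξ : E →L[ℝ] E}
  {Dη : E →L[ℝ] E →L[ℝ] ℝ}

namespace NormalJet

variable (H : NormalJet a ξ η D Dξ Dη)
include H

/-- With `ξ` as first argument, `aξ = 0` reduces the Nijenhuis tensor to `-a((L_ξ a) b)`. The
bracketed expression is the Lie derivative `L_ξ a` evaluated on a constant vector. -/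
theorem lie_aux (b : E) :
    -(a (D ξ b - Dξ (a b) + a (Dξ b))) + (Dη ξ b - Dη b ξ) • ξ = 0 := by
  have h := H.normal ξ b
  have h1 := H.deriv_apply_xi (a b)
  have h2 := congrArg a (H.deriv_apply_xi b)
  simp only [nijAlg, H.apply_xi, map_zero, zero_apply, map_add] at h h2
  simp only [map_add, map_sub]
  linear_combination (norm := module) h + h1 - h2

/-- The Lie derivative of `η` along `ξ` vanishes. -/
theorem lie_eta (b : E) : Dη ξ b - Dη b ξ = 0 := by
  -- Since `η ∘ a = 0`, only the coefficient of `ξ` survives.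
  have h := congrArg η (H.lie_aux b)
  simpa [H.eta_apply, H.eta_xi] using h

/-- The Lie derivative of `a` along `ξ` vanishes. -/
theorem lie_end (b : E) : D ξ b - Dξ (a b) + a (Dξ b) = 0 := by
  have h := H.lie_aux b
  rw [H.lie_eta b, zero_smul, add_zero, neg_eq_zero] at h
  have h1 := H.sq (D ξ b - Dξ (a b) + a (Dξ b))
  -- The vector is already known to lie in the kernel of `a`, which is spanned by `ξ`; it remains to
  -- see that its `η` component vanishes. This follows from the derivatives of `η ∘ a = 0` and `η(ξ)
  -- = 1` together with `L_ξ η = 0`.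
  have h2 : η (D ξ b - Dξ (a b) + a (Dξ b)) = 0 := by
    rw [map_add, map_sub, H.eta_apply]
    linear_combination H.deriv_eta_apply ξ b - H.deriv_eta_xi (a b) - H.lie_eta (a b)
  rw [h, map_zero, h2, zero_smul, add_zero] at h1
  exact neg_eq_zero.1 h1.symm

/-- Applying `η` to the normality equation leaves `η(D(au)v) - η(D(av)u)` from the Nijenhuis tensor;
differentiating `η ∘ a = 0` turns this into `-dη(au, av)`. -/
theorem extD_invariant (u v : E) :
    Dη (a u) (a v) - Dη (a v) (a u) = Dη u v - Dη v u := by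
  have h := congrArg η (H.normal u v)
  simp only [nijAlg, map_add, map_sub, map_smul, H.eta_apply, H.eta_xi, map_zero, smul_eq_mul]
    at h
  linear_combination H.deriv_eta_apply (a u) v - H.deriv_eta_apply (a v) u - h

/-- Replace `v` by `av` in the invariance of `dη`; the extra term along `ξ` dies because `L_ξ η =
0`. -/
theorem extD_skew (u v : E) :
    Dη (a u) v - Dη v (a u) + (Dη u (a v) - Dη (a v) u) = 0 := by
  have h := H.extD_invariant u (a v)
  rw [H.sq] at h
  simp only [map_add, map_neg, map_smul, add_apply, neg_apply, smul_apply, smul_eq_mul] at h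
  linear_combination -h - η v * H.lie_eta (a u)

end NormalJet

/-- If the almost complex structure `J` on the total space is given by
`Θ J = - η Pr`, `Pr J = a Pr + Θ ξ`, where the almost contact structure `(a, ξ, η)` is normal and the
curvature of `Θ` is invariant under `a`, then the Nijenhuis tensor of `J` vanishes. -/
theorem NormalJet.nijAlg_eq_zero (H : NormalJet a ξ η D Dξ Dη)
    {Pr : E' →L[ℝ] E} {Pr₂ : E' →L[ℝ] E' →L[ℝ] E} (hsym : ∀ u v, Pr₂ u v = Pr₂ v u)
    {Θ : E' →L[ℝ] ℝ} {DΘ : E' →L[ℝ] E' →L[ℝ] ℝ} {J : E' →L[ℝ] E'} {DJ : E' →L[ℝ] E' →L[ℝ] E'}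
    (hΘ : ∀ v, Θ (J v) = -η (Pr v)) (hPr : ∀ v, Pr (J v) = a (Pr v) + Θ v • ξ)
    (dΘ : ∀ u v, DΘ u (J v) + Θ (DJ u v) = -(Dη (Pr u) (Pr v) + η (Pr₂ u v)))
    (dPr : ∀ u v, Pr₂ u (J v) + Pr (DJ u v) =
      D (Pr u) (Pr v) + a (Pr₂ u v) + DΘ u v • ξ + Θ v • Dξ (Pr u))
    {Ω : E → E → ℝ} (hcurv : ∀ u v, DΘ u v - DΘ v u = Ω (Pr u) (Pr v))
    (hΩ : ∀ (u v : E) (s t : ℝ), Ω (a u + s • ξ) (a v + t • ξ) = Ω u v)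
    (hΩ' : ∀ (u v : E) (s t : ℝ), Ω (a u + s • ξ) v + Ω u (a v + t • ξ) = 0)
    (hinj : ∀ w, Pr w = 0 → Θ w = 0 → w = 0) (u v : E') : nijAlg J DJ u v = 0 := by
  -- The differentiated defining equations of `J` determine both components of `DJ`.
  have eΘ : ∀ u v, Θ (DJ u v) = -(Dη (Pr u) (Pr v) + η (Pr₂ u v)) - DΘ u (J v) :=
    fun u v => eq_sub_of_add_eq' (dΘ u v)
  have ePr : ∀ u v, Pr (DJ u v) =
      D (Pr u) (Pr v) + a (Pr₂ u v) + DΘ u v • ξ + Θ v • Dξ (Pr u) - Pr₂ u (J v) :=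
    fun u v => eq_sub_of_add_eq' (dPr u v)
  -- Both identities express that the curvature has type `(1, 1)` for `J`. This one serves the base
  -- component, the invariant form `hcJ` the vertical one.
  have hc : ∀ u v, DΘ (J u) v - DΘ v (J u) + (DΘ u (J v) - DΘ (J v) u) = 0 := by
    intro u v
    rw [hcurv, hcurv, hPr, hPr]
    exact hΩ' _ _ _ _
  have hcJ : DΘ (J u) (J v) - DΘ (J v) (J u) = DΘ u v - DΘ v u := by
    rw [hcurv, hcurv, hPr, hPr]
    exact hΩ _ _ _ _
  apply hinj
  -- Base component: the second derivatives of the projection cancel by symmetry. What is left is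
  -- the normality tensor, two terms with `L_ξ a`, and the curvature times `ξ`.
  · have hN := H.normal (Pr u) (Pr v)
    have lu := H.lie_end (Pr u)
    have lv := H.lie_end (Pr v)
    have hcuv := hc u v
    simp only [nijAlg] at hN ⊢
    simp only [map_add, map_sub, hPr, ePr, eΘ, map_smul, H.sq, H.apply_xi, add_apply,
      smul_apply]
    rw [hsym (J u) v, hsym (J v) u, hsym (J v) (J u), hsym v u]
    linear_combination (norm := module) hN + Θ u • lv - Θ v • lu + hcuv • ξ
  -- Vertical component: what is left is the skew identity for `dη`, terms with `L_ξ η`, and the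
  -- invariance of the curvature.
  · have hs := H.extD_skew (Pr u) (Pr v)
    have lu := H.lie_eta (Pr u)
    have lv := H.lie_eta (Pr v)
    have hxu := H.deriv_eta_xi (Pr u)
    have hxv := H.deriv_eta_xi (Pr v)
    have d1 := H.deriv_eta_apply (Pr v) (Pr u)
    have d2 := H.deriv_eta_apply (Pr u) (Pr v)
    simp only [nijAlg]
    simp only [map_add, map_sub, hPr, hΘ, ePr, eΘ, map_smul, H.eta_apply, H.eta_xi,
      add_apply, smul_apply, smul_eq_mul]
    rw [hsym (J u) v, hsym (J v) u]
    linear_combination -hs - hcJ - Θ u * lv + Θ v * lu - d1 + d2 - Θ u * hxv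
      + Θ v * hxu

end Algebra

/-! ### Normal almost contact metric structures in charts -/

section ContactCharts

variable {m : ℕ} {N : Type*} [TopologicalSpace N] [ChartedSpace (Eucl m) N]
  [IsManifold (𝓡 m) ∞ N] {A : N → Eucl m →L[ℝ] Eucl m} {ξ : N → Eucl m}
  {η : N → Eucl m →L[ℝ] ℝ} {g : RMetric (m := m) N}

theorem locEnd_apply (B : N → Eucl m →L[ℝ] Eucl m) {x : N} {y : Eucl m}
    (v : Eucl m) : locEnd B x y v = chartDinv x ((extChartAt (𝓡 m) x).symm y)
      (B ((extChartAt (𝓡 m) x).symm y) (chartD x y v)) := rfl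

theorem locCo_locEnd (B : N → Eucl m →L[ℝ] Eucl m) {x : N} {y : Eucl m}
    (hy : y ∈ (extChartAt (𝓡 m) x).target) (v : Eucl m) :
    locCo η x y (locEnd B x y v) = η ((extChartAt (𝓡 m) x).symm y)
      (B ((extChartAt (𝓡 m) x).symm y) (chartD x y v)) := by
  rw [locEnd_apply, locCo, ContinuousLinearMap.comp_apply, chartD_chartDinv hy]

/-- The derivative identities come from differentiating `Aξ = 0`, `η ∘ A = 0` and `η(ξ) = 1` in the
chart, where they hold on a neighbourhood. -/
theorem normalJet (H : IsAlmostContactMetric (m := m) A ξ η g) (hn : IsNormal (m := m) A ξ η)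
    (x : N) : NormalJet (A x) (ξ x) (η x) (fderiv ℝ (locEnd A x) (extChartAt (𝓡 m) x x))
      (fderiv ℝ (locVec ξ x) (extChartAt (𝓡 m) x x))
      (fderiv ℝ (locCo η x) (extChartAt (𝓡 m) x x)) := by
  have hη : FormSmooth (m := m) (oneForm η) := H.smooth_form.formSmooth
  have dA := ((smoothEnd_iff.1 H.smooth_end x).differentiableAt (by simp)).hasFDerivAt
  have dξ := ((smoothVFieldAt_iff.1 (H.smooth_vector x)).differentiableAt (by simp)).hasFDerivAt
  have dη := ((contDiffAt_locCo hη x).differentiableAt (by simp)).hasFDerivAt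
  have tg := extChartAt_target_mem_nhds (I := 𝓡 m) x
  have e1 : (fun y => locEnd A x y (locVec ξ x y)) =ᶠ[nhds (extChartAt (𝓡 m) x x)]
      fun _ => 0 := by
    refine (locVec_apply x).symm.trans (Filter.Eventually.of_forall fun y => ?_)
    exact (congrArg (chartDinv x ((extChartAt (𝓡 m) x).symm y))
      (H.apply_xi ((extChartAt (𝓡 m) x).symm y))).trans (map_zero _)
  have e2 : ∀ w, (fun y => locCo η x y (locEnd A x y w)) =ᶠ[nhds (extChartAt (𝓡 m) x x)]
      fun _ => 0 := by
    intro w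
    filter_upwards [tg] with y hy
    exact (locCo_locEnd A hy w).trans (H.eta_apply ((extChartAt (𝓡 m) x).symm y) _)
  have e3 : (fun y => locCo η x y (locVec ξ x y)) =ᶠ[nhds (extChartAt (𝓡 m) x x)]
      fun _ => 1 := by
    filter_upwards [tg] with y hy
    refine Eq.trans ?_ (H.eta_xi ((extChartAt (𝓡 m) x).symm y))
    exact congrArg (η ((extChartAt (𝓡 m) x).symm y)) (chartD_chartDinv hy _)
  have f1 := (dA.clm_apply dξ).unique ((hasFDerivAt_const 0 _).congr_of_eventuallyEq e1)
  have f2 := fun w => (dη.clm_apply (dA.clm_apply (hasFDerivAt_const w _))).unique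
    ((hasFDerivAt_const 0 _).congr_of_eventuallyEq (e2 w))
  have f3 := (dη.clm_apply dξ).unique ((hasFDerivAt_const 1 _).congr_of_eventuallyEq e3)
  rw [locEnd_self, locVec_self] at f1
  rw [locCo_self, locVec_self] at f3
  refine ⟨H.sq x, H.eta_xi x, H.apply_xi x, H.eta_apply x, fun v => ?_, fun v w => ?_,
    fun v => ?_, fun u v => ?_⟩
  · simpa [add_comm] using congrArg (fun L : Eucl m →L[ℝ] Eucl m => L v) f1
  · have := congrArg (fun L : Eucl m →L[ℝ] ℝ => L v) (f2 w)
    rw [locEnd_self, locCo_self] at this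
    simpa [add_comm] using this
  · simpa [add_comm] using congrArg (fun L : Eucl m →L[ℝ] ℝ => L v) f3
  · rw [← extD_oneForm hη x u v]
    exact isNormal_pointwise H.smooth_end hn x u v

end ContactCharts

/-! ### The induced complex structures on the total space -/

section Total

variable {m m' : ℕ}
  {N : Type*} [TopologicalSpace N] [ChartedSpace (Eucl m) N] [IsManifold (𝓡 m) ∞ N]
  {P : Type*} [TopologicalSpace P] [ChartedSpace (Eucl m') P] [IsManifold (𝓡 m') ∞ P]

/-- The derivative of a map between manifolds, between the model spaces. -/
def dmap (f : P → N) (p : P) : Eucl m' →L[ℝ] Eucl m := mfderiv (𝓡 m') (𝓡 m) f p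

/-- The smooth map `π` and the smooth `1`-form `θ` split the tangent spaces of `P`. -/
structure IsSplitting (π : P → N) (θ : P → Eucl m' →L[ℝ] ℝ) : Prop where
  smooth_proj : ContMDiff (𝓡 m') (𝓡 m) ∞ π
  smooth_form : FormSmooth (m := m') (oneForm θ)
  invertible : ∀ p, ((dmap (m := m) π p).prod (θ p)).IsInvertible

/-- `J` is the almost complex structure on `P` induced by an almost contact structure. -/
structure IsInduced (π : P → N) (θ : P → Eucl m' →L[ℝ] ℝ) (A : N → Eucl m →L[ℝ] Eucl m)
    (ξ : N → Eucl m) (η : N → Eucl m →L[ℝ] ℝ) (J : P → Eucl m' →L[ℝ] Eucl m') : Prop where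
  theta : ∀ p v, θ p (J p v) = -η (π p) (dmap π p v)
  proj : ∀ p v, dmap π p (J p v) = A (π p) (dmap π p v) + θ p v • ξ (π p)

variable {π : P → N} {θ : P → Eucl m' →L[ℝ] ℝ} {A : N → Eucl m →L[ℝ] Eucl m} {ξ : N → Eucl m}
  {η : N → Eucl m →L[ℝ] ℝ} {J : P → Eucl m' →L[ℝ] Eucl m'}

/-- A map in the charts at a point and at its image. -/
abbrev locMap (π : P → N) (p : P) : Eucl m' → Eucl m := chartMap (m := m) (m' := m') π p (π p)

theorem contDiffAt_locMap (hπ : ContMDiff (𝓡 m') (𝓡 m) ∞ π) (p : P) :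
    ContDiffAt ℝ ∞ (locMap (m := m) π p) (extChartAt (𝓡 m') p p) :=
  have h := (eventually_chart hπ p).self_of_nhds
  contDiffAt_chartMap hπ h.1 h.2

theorem fderiv_locMap (hπ : ContMDiff (𝓡 m') (𝓡 m) ∞ π) (p : P) :
    fderiv ℝ (locMap π p) (extChartAt (𝓡 m') p p) = dmap (m := m) π p := by
  ext1 v
  exact fderiv_chartMap_self hπ p v

theorem eventually_chartD_locMap (hπ : ContMDiff (𝓡 m') (𝓡 m) ∞ π) (p : P) :
    ∀ᶠ y in nhds (extChartAt (𝓡 m') p p), y ∈ (extChartAt (𝓡 m') p).target ∧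
      locMap (m := m) π p y ∈ (extChartAt (𝓡 m) (π p)).target ∧
      (extChartAt (𝓡 m) (π p)).symm (locMap π p y) = π ((extChartAt (𝓡 m') p).symm y) ∧
      ∀ v, chartD (π p) (locMap (m := m) π p y) (fderiv ℝ (locMap π p) y v) =
        dmap π ((extChartAt (𝓡 m') p).symm y) (chartD p y v) := by
  filter_upwards [eventually_chart hπ p] with y hy
  have h1 : (extChartAt (𝓡 m) (π p)).symm (locMap π p y) = π ((extChartAt (𝓡 m') p).symm y) :=
    (extChartAt (𝓡 m) (π p)).left_inv hy.2
  have h2 : locMap (m := m) π p y ∈ (extChartAt (𝓡 m) (π p)).target :=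
    (extChartAt _ (π p)).map_source hy.2
  refine ⟨hy.1, h2, h1, fun v => ?_⟩
  rw [fderiv_chartMap hπ hy.1 hy.2, ← h1]
  exact chartD_chartDinv h2 _

/-- The defining equations of `J` hold at all points of `P`. Their local expressions therefore hold
near the base point, not only at it, and may be differentiated there. -/
theorem IsInduced.eventually_theta (HJ : IsInduced π θ A ξ η J)
    (hπ : ContMDiff (𝓡 m') (𝓡 m) ∞ π) (p : P) :
    ∀ᶠ y in nhds (extChartAt (𝓡 m') p p), ∀ v, locCo θ p y (locEnd J p y v) =
      -locCo η (π p) (locMap π p y) (fderiv ℝ (locMap π p) y v) := by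
  filter_upwards [eventually_chartD_locMap hπ p] with y hy v
  obtain ⟨h0, -, h1, h2⟩ := hy
  rw [locCo_locEnd J h0, HJ.theta, locCo, ContinuousLinearMap.comp_apply, h2, h1]

theorem IsInduced.eventually_proj (HJ : IsInduced π θ A ξ η J)
    (hπ : ContMDiff (𝓡 m') (𝓡 m) ∞ π) (p : P) :
    ∀ᶠ y in nhds (extChartAt (𝓡 m') p p), ∀ v,
      fderiv ℝ (locMap π p) y (locEnd J p y v) =
        locEnd A (π p) (locMap π p y) (fderiv ℝ (locMap π p) y v) +
          locCo θ p y v • locVec ξ (π p) (locMap π p y) := by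
  filter_upwards [eventually_chartD_locMap hπ p] with y hy v
  obtain ⟨h0, h3, h1, h2⟩ := hy
  rw [← chartDinv_chartD h3 (fderiv ℝ (locMap π p) y (locEnd J p y v)), h2, locEnd_apply,
    chartD_chartDinv h0, HJ.proj, locEnd_apply, h2, h1, map_add, map_smul, locVec, h1]
  rfl

/-- The local expression of the splitting. -/
def locSplit (π : P → N) (θ : P → Eucl m' →L[ℝ] ℝ) (p : P) (y : Eucl m') :
    Eucl m' →L[ℝ] Eucl m × ℝ :=
  (fderiv ℝ (locMap π p) y).prod (locCo θ p y)

theorem IsSplitting.contDiffAt_fderiv (S : IsSplitting (m := m) π θ) (p : P) :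
    ContDiffAt ℝ ∞ (fderiv ℝ (locMap (m := m) π p)) (extChartAt (𝓡 m') p p) :=
  (contDiffAt_locMap S.smooth_proj p).fderiv_right (m := ∞) (by simp)

theorem IsSplitting.contDiffAt_locSplit (S : IsSplitting (m := m) π θ) (p : P) :
    ContDiffAt ℝ ∞ (locSplit (m := m) π θ p) (extChartAt (𝓡 m') p p) :=
  contDiffAt_clm fun _ => ((S.contDiffAt_fderiv p).clm_apply contDiffAt_const).prodMk
    ((contDiffAt_locCo S.smooth_form p).clm_apply contDiffAt_const)

theorem IsSplitting.eventually_invertible (S : IsSplitting (m := m) π θ) (p : P) :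
    ∀ᶠ y in nhds (extChartAt (𝓡 m') p p), (locSplit (m := m) π θ p y).IsInvertible := by
  obtain ⟨e, he⟩ := S.invertible p
  refine (S.contDiffAt_locSplit p).continuousAt.eventually ?_
  rw [locSplit, fderiv_locMap S.smooth_proj, locCo_self, ← he]
  exact ContinuousLinearEquiv.nhds e

/-- Locally `J` is found by solving its two defining equations, that is, by applying the inverse of
the splitting to smooth data. Inversion is smooth on invertible operators. -/
theorem smoothEnd_of_isInduced (S : IsSplitting (m := m) π θ) (HJ : IsInduced π θ A ξ η J)
    (hA : SmoothEnd (m := m) A) (hξ : ∀ x, SmoothVFieldAt (m := m) ξ x)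
    (hη : FormSmooth (m := m) (oneForm η)) : SmoothEnd (m := m') J := by
  refine smoothEnd_iff.2 fun p => ?_
  have hK := contDiffAt_locMap S.smooth_proj p
  have hA' := (smoothEnd_iff.1 hA (π p))
  have hξ' := (smoothVFieldAt_iff.1 (hξ (π p)))
  have hη' := (contDiffAt_locCo hη (π p))
  rw [← chartMap_self (m' := m')] at hA' hξ' hη'
  have hA'' := hA'.comp _ hK
  have hξ'' := hξ'.comp _ hK
  have hη'' := hη'.comp _ hK
  have hT := S.contDiffAt_fderiv p
  have hθ := contDiffAt_locCo S.smooth_form p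
  have hinv : ContDiffAt ℝ ∞ (fun y => (locSplit (m := m) π θ p y).inverse)
      (extChartAt (𝓡 m') p p) := by
    obtain ⟨e, he⟩ := (S.eventually_invertible p).self_of_nhds
    refine ContDiffAt.comp _ (g := ContinuousLinearMap.inverse) ?_ (S.contDiffAt_locSplit p)
    rw [← he]
    exact contDiffAt_map_inverse e
  refine contDiffAt_clm fun v => ?_
  refine (contDiffAt_congr (g := fun y => (locSplit (m := m) π θ p y).inverse
    (locEnd A (π p) (locMap π p y) (fderiv ℝ (locMap π p) y v) +
          locCo θ p y v • locVec ξ (π p) (locMap π p y),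
      -locCo η (π p) (locMap π p y) (fderiv ℝ (locMap π p) y v))) ?_).2 ?_
  · filter_upwards [S.eventually_invertible p, HJ.eventually_theta S.smooth_proj p,
      HJ.eventually_proj S.smooth_proj p] with y h1 h2 h3
    refine (h1.inverse_apply_eq.2 ?_).symm
    exact Prod.ext (h3 v).symm (h2 v).symm
  · have hTv := hT.clm_apply (contDiffAt_const (c := v))
    exact hinv.clm_apply (((hA''.clm_apply hTv).add
      ((hθ.clm_apply contDiffAt_const).smul hξ'')).prodMk (hη''.clm_apply hTv).neg)

end Total

/-! ### Multilinear expansion of forms of degree two and three. -/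

section AltExpand

variable {V : Type*} [AddCommGroup V] [Module ℝ V] [TopologicalSpace V]

theorem alt_two_add (a : V [⋀^Fin 2]→L[ℝ] ℝ) (u u' v : V) :
    a ![u + u', v] = a ![u, v] + a ![u', v] := a.vecCons_add ![v] u u'

theorem alt_two_smul (a : V [⋀^Fin 2]→L[ℝ] ℝ) (c : ℝ) (u v : V) :
    a ![c • u, v] = c * a ![u, v] := a.vecCons_smul ![v] c u

theorem alt_two_add_right (a : V [⋀^Fin 2]→L[ℝ] ℝ) (u v v' : V) :
    a ![u, v + v'] = a ![u, v] + a ![u, v'] := by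
  rw [alt_swap a u, alt_two_add, alt_swap a v, alt_swap a v']
  ring

theorem alt_two_smul_right (a : V [⋀^Fin 2]→L[ℝ] ℝ) (c : ℝ) (u v : V) :
    a ![u, c • v] = c * a ![u, v] := by
  rw [alt_swap a u, alt_two_smul, alt_swap a v]
  ring

theorem alt_three_add (a : V [⋀^Fin 3]→L[ℝ] ℝ) (u u' v w : V) :
    a ![u + u', v, w] = a ![u, v, w] + a ![u', v, w] := a.vecCons_add ![v, w] u u'

theorem alt_three_smul (a : V [⋀^Fin 3]→L[ℝ] ℝ) (c : ℝ) (u v w : V) :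
    a ![c • u, v, w] = c * a ![u, v, w] := a.vecCons_smul ![v, w] c u

theorem alt_three_swap (a : V [⋀^Fin 3]→L[ℝ] ℝ) (u v w : V) :
    a ![u, v, w] = -a ![v, u, w] := by
  refine Eq.trans (congrArg a ?_) (a.map_swap ![v, u, w] (i := 0) (j := 1) (by decide))
  funext j
  fin_cases j <;> rfl

theorem alt_three_rotate (a : V [⋀^Fin 3]→L[ℝ] ℝ) (u v w : V) :
    a ![u, v, w] = a ![w, u, v] := by
  rw [alt_three_swap, neg_eq_iff_eq_neg]
  refine Eq.trans (congrArg a ?_) (a.map_swap ![w, u, v] (i := 0) (j := 2) (by decide))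
  funext j
  fin_cases j <;> rfl

theorem alt_three_self (a : V [⋀^Fin 3]→L[ℝ] ℝ) (u w : V) : a ![u, u, w] = 0 :=
  a.map_eq_zero_of_eq ![u, u, w] (i := 0) (j := 1) rfl (by decide)

/-- Expansion of a `3`-form on vectors with components along a fixed vector. -/
theorem alt_three_expand (a : V [⋀^Fin 3]→L[ℝ] ℝ) (x u v w : V) (r s t : ℝ) :
    a ![u + r • x, v + s • x, w + t • x] = a ![u, v, w] + r * a ![x, v, w] - s * a ![x, u, w]
      + t * a ![x, u, v] := by
  have h0 : ∀ p : V, a ![x, p, x] = 0 := fun p => by rw [alt_three_rotate, alt_three_self]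
  have h2 : ∀ p : V, a ![p, v + s • x, w + t • x] = a ![p, v, w] + s * a ![p, x, w]
      + t * a ![p, v, x] + s * t * a ![p, x, x] := by
    intro p
    rw [alt_three_rotate, alt_three_add, alt_three_smul, alt_three_rotate a w,
      alt_three_rotate a x p, alt_three_add, alt_three_add, alt_three_smul, alt_three_smul,
      alt_three_rotate a v w, alt_three_rotate a x w, alt_three_rotate a v x,
      alt_three_rotate a x x]
    ring
  rw [alt_three_add, alt_three_smul, h2, h2, alt_three_self, alt_three_swap a u x w,
    alt_three_rotate a u v x, h0, alt_three_rotate a u x x]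
  linear_combination s * t * h0 u + s * t * r * h0 x

end AltExpand

/-! ### Integrability of the induced almost complex structures. -/

section Total

variable {m m' : ℕ}
  {N : Type*} [TopologicalSpace N] [ChartedSpace (Eucl m) N] [IsManifold (𝓡 m) ∞ N]
  {P : Type*} [TopologicalSpace P] [ChartedSpace (Eucl m') P] [IsManifold (𝓡 m') ∞ P]
  {π : P → N} {θ : P → Eucl m' →L[ℝ] ℝ} {A : N → Eucl m →L[ℝ] Eucl m} {ξ : N → Eucl m}
  {η : N → Eucl m →L[ℝ] ℝ} {J : P → Eucl m' →L[ℝ] Eucl m'} {g : RMetric (m := m) N}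
  {Ω : N → Eucl m [⋀^Fin 2]→L[ℝ] ℝ}

theorem IsSplitting.ext (S : IsSplitting (m := m) π θ) {p : P} {v w : Eucl m'}
    (h1 : dmap (m := m) π p v = dmap π p w) (h2 : θ p v = θ p w) : v = w :=
  (S.invertible p).injective (Prod.ext h1 h2)

/-- Invariance gives `Ω(ξ, v) = Ω(Aξ, Av)`, and `Aξ = 0`. -/
theorem IsAlmostContactMetric.inv_xi (H : IsAlmostContactMetric (m := m) A ξ η g) {x : N}
    (hΩ : act (m := m) A Ω = Ω) (v : Eucl m) : Ω x ![ξ x, v] = 0 := by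
  have h : Ω x (A x ∘ ![ξ x, v]) = Ω x ![ξ x, v] :=
    congrArg (fun β : N → Eucl m [⋀^Fin 2]→L[ℝ] ℝ => β x ![ξ x, v]) hΩ
  rw [← h]
  exact (Ω x).map_coord_zero 0 (H.apply_xi x)

theorem inv_apply (hΩ : act (m := m) A Ω = Ω) (x : N) (u v : Eucl m) :
    Ω x ![A x u, A x v] = Ω x ![u, v] := by
  refine Eq.trans ?_ (congrArg (fun β : N → Eucl m [⋀^Fin 2]→L[ℝ] ℝ => β x ![u, v]) hΩ)
  refine congrArg (Ω x) ?_
  funext j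
  fin_cases j <;> rfl

/-- The induced almost complex structure is integrable. -/
theorem isComplex_of_isInduced (S : IsSplitting (m := m) π θ) (HJ : IsInduced π θ A ξ η J)
    (H : IsAlmostContactMetric (m := m) A ξ η g) (hn : IsNormal (m := m) A ξ η)
    (hΩ : act (m := m) A Ω = Ω)
    (hcurv : extD (m := m') (oneForm θ) = pullback (m := m) (m' := m') π Ω) :
    IsComplexStructure (m := m') J := by
  have hη : FormSmooth (m := m) (oneForm η) := H.smooth_form.formSmooth
  have hJ := smoothEnd_of_isInduced S HJ H.smooth_end H.smooth_vector hη
  refine isComplex_pointwise hJ (fun p u v => ?_) fun p v => S.ext (p := p) ?_ ?_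
  · have hK := contDiffAt_locMap S.smooth_proj p
    have dK := (hK.differentiableAt (by simp)).hasFDerivAt
    have dK₂ := ((S.contDiffAt_fderiv p).differentiableAt (by simp)).hasFDerivAt
    have dJ := ((smoothEnd_iff.1 hJ p).differentiableAt (by simp)).hasFDerivAt
    have dθ := ((contDiffAt_locCo S.smooth_form p).differentiableAt (by simp)).hasFDerivAt
    have dA := ((smoothEnd_iff.1 H.smooth_end (π p)).differentiableAt (by simp)).hasFDerivAt
    have dξ := ((smoothVFieldAt_iff.1
      (H.smooth_vector (π p))).differentiableAt (by simp)).hasFDerivAt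
    have dη := ((contDiffAt_locCo hη (π p)).differentiableAt (by simp)).hasFDerivAt
    have hs : IsSymmSndFDerivAt ℝ (locMap (m := m) π p) (extChartAt (𝓡 m') p p) :=
      hK.isSymmSndFDerivAt minSmoothness_two_le
    have key := normalJet H hn (π p)
    -- The chart value of `π p` is rewritten as the value of `locMap π p`, so that the chain rule
    -- along the projection applies.
    rw [← chartMap_self (m' := m')] at dA dξ dη key
    have cA := dA.comp _ dK
    have cξ := dξ.comp _ dK
    have cη := dη.comp _ dK
    refine key.nijAlg_eq_zero (Pr := dmap π p)
      (Pr₂ := fderiv ℝ (fderiv ℝ (locMap π p)) (extChartAt (𝓡 m') p p)) (fun u v => hs u v)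
      (Θ := θ p) (DΘ := fderiv ℝ (locCo θ p) (extChartAt (𝓡 m') p p))
      (HJ.theta p) (HJ.proj p) (fun u v => ?_) (fun u v => ?_)
      (Ω := fun u v => Ω (π p) ![u, v]) (fun u v => ?_) (fun u v s t => ?_) (fun u v s t => ?_)
      (fun w h1 h2 => S.ext (by rw [h1, map_zero]) (by rw [h2, map_zero])) u v
    -- Derivative of the local form of `θ ∘ J = -π^*η`, by uniqueness of the derivative.
    · have h := (dθ.clm_apply (dJ.clm_apply (hasFDerivAt_const v _))).unique
        ((cη.clm_apply (dK₂.clm_apply (hasFDerivAt_const v _))).neg.congr_of_eventuallyEq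
          ((HJ.eventually_theta S.smooth_proj p).mono fun y hy => hy v))
      simp only [locCo_self, locEnd_self, fderiv_locMap S.smooth_proj, chartMap_self,
        Function.comp_apply] at h ⊢
      have h' := congrArg (fun L : Eucl m' →L[ℝ] ℝ => L u) h
      simp at h' ⊢
      linear_combination h'
    -- Derivative of the local form of `π_* J = A π_* + θ ξ`.
    · have h := ((dK₂.clm_apply (dJ.clm_apply (hasFDerivAt_const v _)))).unique
        (((cA.clm_apply (dK₂.clm_apply (hasFDerivAt_const v _))).add
          ((dθ.clm_apply (hasFDerivAt_const v _)).smul cξ)).congr_of_eventuallyEq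
          ((HJ.eventually_proj S.smooth_proj p).mono fun y hy => hy v))
      simp only [locCo_self, locEnd_self, locVec_self, fderiv_locMap S.smooth_proj,
        chartMap_self, Function.comp_apply] at h ⊢
      have h' := congrArg (fun L : Eucl m' →L[ℝ] Eucl m => L u) h
      simp at h' ⊢
      linear_combination (norm := module) h'
    · rw [← extD_oneForm S.smooth_form]
      refine (congrArg (fun β : P → Eucl m' [⋀^Fin 2]→L[ℝ] ℝ => β p ![u, v]) hcurv).trans ?_
      refine congrArg (Ω (π p)) ?_
      funext j
      fin_cases j <;> rfl
    · simp only [alt_two_add, alt_two_smul, H.inv_xi hΩ, alt_two_add_right, alt_two_smul_right,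
        inv_apply hΩ, alt_swap (Ω (π p)) _ (ξ (π p))]
      ring
    -- The skew condition is the invariance of `Ω` applied to `u` and `Av`, rewritten with `A² = -1
    -- + η ⊗ ξ`.
    · have h := inv_apply hΩ (π p) u (A (π p) v)
      have h2 : A (π p) (A (π p) v) = (-1 : ℝ) • v + η (π p) v • ξ (π p) := by
        rw [neg_one_smul]
        exact H.sq (π p) v
      rw [h2] at h
      simp only [alt_two_add, alt_two_smul, H.inv_xi hΩ, alt_two_add_right, alt_two_smul_right,
        alt_swap (Ω (π p)) _ (ξ (π p))] at h ⊢
      linear_combination -h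
  · rw [HJ.proj, HJ.proj, HJ.theta, map_add, map_smul, map_neg]
    have h1 : A (π p) (A (π p) (dmap π p v)) =
        -dmap π p v + η (π p) (dmap π p v) • ξ (π p) := H.sq (π p) _
    have h2 : A (π p) (ξ (π p)) = 0 := H.apply_xi (π p)
    rw [h1, h2]
    module
  · rw [HJ.theta, HJ.proj, map_add, map_smul, map_neg]
    have h1 : η (π p) (A (π p) (dmap π p v)) = 0 := H.eta_apply (π p) _
    have h2 : η (π p) (ξ (π p)) = 1 := H.eta_xi (π p)
    rw [h1, h2]
    simp

end Total

/-! ### The hyper-Hermitian structure -/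

section Metric

variable {m m' : ℕ}
  {N : Type*} [TopologicalSpace N] [ChartedSpace (Eucl m) N] [IsManifold (𝓡 m) ∞ N]
  {P : Type*} [TopologicalSpace P] [ChartedSpace (Eucl m') P] [IsManifold (𝓡 m') ∞ P]
  {π : P → N} {θ : P → Eucl m' →L[ℝ] ℝ} {g : RMetric (m := m) N}
  {h : P → Eucl m' →L[ℝ] Eucl m' →L[ℝ] ℝ}

/-- A Riemannian metric, as a bilinear form on the model space. -/
def RMetric.bil (g : RMetric (m := m) N) (x : N) : Eucl m →L[ℝ] Eucl m →L[ℝ] ℝ := g.inner x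

theorem RMetric.bil_symm (g : RMetric (m := m) N) (x : N) (v w : Eucl m) :
    RMetric.bil g x v w = RMetric.bil g x w v := g.symm x v w

theorem RMetric.contDiffAt_locBil (g : RMetric (m := m) N) (x : N) :
    ContDiffAt ℝ ∞ (locBil (RMetric.bil g) x) (extChartAt (𝓡 m) x x) :=
  smoothBilin_iff.1 g.contMDiff x

/-- `h` is the metric `π^*g + θ ⊗ θ`. -/
def IsInducedMetric (π : P → N) (θ : P → Eucl m' →L[ℝ] ℝ) (g : RMetric (m := m) N)
    (h : P → Eucl m' →L[ℝ] Eucl m' →L[ℝ] ℝ) : Prop :=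
  ∀ p v w, h p v w = RMetric.bil g (π p) (dmap π p v) (dmap π p w) + θ p v * θ p w

theorem IsInducedMetric.contDiffAt_locBil (hh : IsInducedMetric π θ g h)
    (S : IsSplitting (m := m) π θ) (p : P) :
    ContDiffAt ℝ ∞ (locBil h p) (extChartAt (𝓡 m') p p) := by
  have hg := RMetric.contDiffAt_locBil g (π p)
  rw [← chartMap_self (m' := m')] at hg
  have hg' := hg.comp _ (contDiffAt_locMap S.smooth_proj p)
  have hT := fun v : Eucl m' => (S.contDiffAt_fderiv p).clm_apply (contDiffAt_const (c := v))
  have hθ := fun v : Eucl m' =>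
    (contDiffAt_locCo S.smooth_form p).clm_apply (contDiffAt_const (c := v))
  refine contDiffAt_clm fun v => contDiffAt_clm fun w => ?_
  refine (contDiffAt_congr ?_).2
    (((hg'.clm_apply (hT v)).clm_apply (hT w)).add ((hθ v).mul (hθ w)))
  filter_upwards [eventually_chartD_locMap S.smooth_proj p] with y hy
  obtain ⟨-, -, h1, h2⟩ := hy
  simp only [Function.comp_apply, locBil, ContinuousLinearMap.bilinearComp_apply]
  rw [hh, h2, h2, h1]
  rfl

theorem IsInducedMetric.exists_rMetric (hh : IsInducedMetric π θ g h)
    (S : IsSplitting (m := m) π θ) : ∃ h' : RMetric (m := m') P, ∀ p, h'.inner p = h p := by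
  have hpos : ∀ (x : N) (v : Eucl m), v ≠ 0 → 0 < RMetric.bil g x v v := g.pos
  have hnn : ∀ (x : N) (v : Eucl m), 0 ≤ RMetric.bil g x v v := by
    intro x v
    rcases eq_or_ne v 0 with rfl | hv
    · simp
    · exact (hpos x v hv).le
  refine ⟨⟨h, fun p v w => ?_, fun p v hv => ?_, fun p => ?_,
    smoothBilin_iff.2 (hh.contDiffAt_locBil S)⟩, fun p => rfl⟩
  · refine (hh p v w).trans (Eq.trans ?_ (hh p w v).symm)
    rw [RMetric.bil_symm, mul_comm]
  · refine lt_of_lt_of_eq ?_ (hh p v v).symm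
    by_cases h1 : dmap (m := m) π p v = 0
    · have h2 : θ p v ≠ 0 := fun h2 =>
        hv (S.ext (h1.trans (map_zero _).symm) (h2.trans (map_zero _).symm))
      have := mul_self_pos.2 h2
      have := hnn (π p) (dmap π p v)
      positivity
    · have := hpos (π p) _ h1
      have := mul_self_nonneg (θ p v)
      linarith
  -- The metric structure also requires bounded unit balls. The unit ball of `h` lies in the image,
  -- under the inverse of the splitting, of the product of the unit balls of `g` and `ℝ`.
  · have hg : Bornology.IsBounded {v : Eucl m | RMetric.bil g (π p) v v < 1} :=
      (NormedSpace.isVonNBounded_iff ℝ).1 (g.isVonNBounded (π p))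
    refine (NormedSpace.isVonNBounded_iff (E := Eucl m') ℝ).2 ?_
    obtain ⟨e, he⟩ := S.invertible p
    have hb : Bornology.IsBounded
        ({v : Eucl m | RMetric.bil g (π p) v v < 1} ×ˢ Metric.ball (0 : ℝ) 1) :=
      hg.prod Metric.isBounded_ball
    refine (e.symm.lipschitz.isBounded_image hb).subset fun v hv => ?_
    refine ⟨(dmap π p v, θ p v), ⟨?_, ?_⟩, ?_⟩
    · have hv' := lt_of_eq_of_lt (hh p v v).symm hv
      have := mul_self_nonneg (θ p v)
      change RMetric.bil g (π p) (dmap π p v) (dmap π p v) < 1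
      linarith
    · have hv' := lt_of_eq_of_lt (hh p v v).symm hv
      have := hnn (π p) (dmap π p v)
      rw [mem_ball_zero_iff, Real.norm_eq_abs, ← sq_lt_one_iff_abs_lt_one]
      nlinarith
    · refine (congrArg e.symm ?_).trans (e.symm_apply_apply v)
      exact congrArg (fun L : Eucl m' →L[ℝ] Eucl m × ℝ => L v) he.symm

variable {A : N → Eucl m →L[ℝ] Eucl m} {ξ : N → Eucl m} {η : N → Eucl m →L[ℝ] ℝ}
  {J : P → Eucl m' →L[ℝ] Eucl m'}

/-- Compatibility with `ξ` as second argument has left side zero, because `Aξ = 0`. -/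
theorem IsAlmostContactMetric.bil_xi (H : IsAlmostContactMetric (m := m) A ξ η g) (x : N)
    (v : Eucl m) : RMetric.bil g x v (ξ x) = η x v := by
  have h1 : RMetric.bil g x (A x v) (A x (ξ x)) = RMetric.bil g x v (ξ x) - η x v * η x (ξ x) :=
    H.compat x v (ξ x)
  have h2 : A x (ξ x) = 0 := H.apply_xi x
  have h3 : η x (ξ x) = 1 := H.eta_xi x
  rw [h2, h3, map_zero] at h1
  linarith

theorem IsInducedMetric.compat (hh : IsInducedMetric π θ g h) (HJ : IsInduced π θ A ξ η J)
    (H : IsAlmostContactMetric (m := m) A ξ η g) (p : P) (v w : Eucl m') :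
    h p (J p v) (J p w) = h p v w := by
  have h1 : ∀ x v, η x (A x v) = 0 := H.eta_apply
  have h2 : ∀ x, η x (ξ x) = 1 := H.eta_xi
  have h3 : ∀ x v w, RMetric.bil g x (A x v) (A x w) = RMetric.bil g x v w - η x v * η x w :=
    H.compat
  rw [hh, hh, HJ.theta, HJ.theta, HJ.proj, HJ.proj]
  simp only [map_add, map_smul, _root_.add_apply, _root_.smul_apply, H.bil_xi, h1, h2, h3,
    RMetric.bil_symm g _ (ξ (π p)), smul_eq_mul]
  ring

theorem IsInducedMetric.skew (hh : IsInducedMetric π θ g h) (HJ : IsInduced π θ A ξ η J)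
    (H : IsAlmostContactMetric (m := m) A ξ η g) (hJ : IsComplexStructure (m := m') J)
    (p : P) (v w : Eucl m') :
    h p v (J p w) = -h p w (J p v) := by
  have h1 := hh.compat HJ H p v (J p w)
  have h2 : J p (J p w) = -w := hJ.sq p w
  rw [← h1, h2, map_neg, hh, hh, RMetric.bil_symm]
  ring

end Metric

/-! ### The quaternionic relations on the total space. -/

section Quaternionic

variable {m m' : ℕ}
  {N : Type*} [TopologicalSpace N] [ChartedSpace (Eucl m) N] [IsManifold (𝓡 m) ∞ N]
  {P : Type*} [TopologicalSpace P] [ChartedSpace (Eucl m') P] [IsManifold (𝓡 m') ∞ P]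
  {π : P → N} {θ : P → Eucl m' →L[ℝ] ℝ} {g : RMetric (m := m) N}
  {h : P → Eucl m' →L[ℝ] Eucl m' →L[ℝ] ℝ}
  {A : Fin 3 → N → Eucl m →L[ℝ] Eucl m} {ξ : Fin 3 → N → Eucl m}
  {η : Fin 3 → N → Eucl m →L[ℝ] ℝ} {J : Fin 3 → P → Eucl m' →L[ℝ] Eucl m'}
  {Ω : N → Eucl m [⋀^Fin 2]→L[ℝ] ℝ}

theorem isHyperHermitian_of_isInduced (S : IsSplitting (m := m) π θ)
    (hh : IsInducedMetric π θ g h) (HJ : ∀ r, IsInduced π θ (A r) (ξ r) (η r) (J r))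
    (H : ∀ r, IsAlmostContactMetric (m := m) (A r) (ξ r) (η r) g)
    (hn : ∀ r, IsNormal (m := m) (A r) (ξ r) (η r))
    (hq : QuaternionicRelations (m := m) A ξ η)
    (hΩ : ∀ r, act (m := m) (A r) Ω = Ω)
    (hcurv : extD (m := m') (oneForm θ) = pullback (m := m) (m' := m') π Ω) :
    IsHyperHermitian (m := m') J h where
  metric := hh.exists_rMetric S
  complex r := isComplex_of_isInduced S (HJ r) (H r) (hn r) (hΩ r) hcurv
  compat r := hh.compat (HJ r) (H r)
  quaternionic := by
    suffices key : ∀ (p : P) (v : Eucl m'), J 0 p (J 1 p v) = J 2 p v ∧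
        J 1 p (J 0 p v) = -J 2 p v from key
    intro p v
    have a1 : ∀ x u, A 2 x u = A 0 x (A 1 x u) - η 1 x u • ξ 0 x := hq.end_left 0
    have a2 : ∀ x u, A 2 x u = -A 1 x (A 0 x u) + η 0 x u • ξ 1 x := hq.end_right 0
    have x1 : ∀ x, ξ 2 x = A 0 x (ξ 1 x) := hq.xi_left 0
    have x2 : ∀ x, ξ 2 x = -A 1 x (ξ 0 x) := hq.xi_right 0
    have e1 : ∀ x u, η 2 x u = η 0 x (A 1 x u) := hq.eta_left 0
    have e2 : ∀ x u, η 2 x u = -η 1 x (A 0 x u) := hq.eta_right 0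
    -- The vector `ξ 1` lies in the image of `A 0`, which `η 0` annihilates. The relation used is
    -- the one with `i = 2`, whose indices wrap around in `Fin 3`.
    have z1 : ∀ x, η 0 x (ξ 1 x) = 0 := fun x => by
      have : ξ 1 x = -A 0 x (ξ 2 x) := hq.xi_right 2 x
      rw [this, map_neg, neg_eq_zero]
      exact (H 0).eta_apply x _
    have z2 : ∀ x, η 1 x (ξ 0 x) = 0 := fun x => by
      have : ξ 0 x = A 1 x (ξ 2 x) := hq.xi_left 1 x
      rw [this]
      exact (H 1).eta_apply x _
    refine ⟨S.ext (p := p) ?_ ?_, S.ext (p := p) ?_ ?_⟩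
    · rw [(HJ 0).proj, (HJ 1).proj, (HJ 2).proj, (HJ 1).theta, a1, x1, map_add, map_smul]
      module
    · rw [(HJ 0).theta, (HJ 1).proj, (HJ 2).theta, map_add, map_smul, z1, e1]
      simp
    · rw [(HJ 1).proj, (HJ 0).proj, (HJ 0).theta, map_add, map_smul, map_neg, (HJ 2).proj, a2, x2]
      module
    · rw [(HJ 1).theta, (HJ 0).proj, map_add, map_smul, z2, map_neg, (HJ 2).theta, e2]
      simp

end Quaternionic

/-! ### The torsion form -/

section Torsion

variable {m m' : ℕ}
  {N : Type*} [TopologicalSpace N] [ChartedSpace (Eucl m) N] [IsManifold (𝓡 m) ∞ N]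
  {P : Type*} [TopologicalSpace P] [ChartedSpace (Eucl m') P] [IsManifold (𝓡 m') ∞ P]
  {π : P → N} {θ : P → Eucl m' →L[ℝ] ℝ} {g : RMetric (m := m) N}
  {h : P → Eucl m' →L[ℝ] Eucl m' →L[ℝ] ℝ}
  {A : N → Eucl m →L[ℝ] Eucl m} {ξ : N → Eucl m} {η : N → Eucl m →L[ℝ] ℝ}
  {J : P → Eucl m' →L[ℝ] Eucl m'} {Ω : N → Eucl m [⋀^Fin 2]→L[ℝ] ℝ}

/-- The pullback of forms, between forms with values in the model spaces. -/
def modelPullback (π : P → N) {k : ℕ} (β : N → Eucl m [⋀^Fin k]→L[ℝ] ℝ) :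
    P → Eucl m' [⋀^Fin k]→L[ℝ] ℝ := pullback (m := m) (m' := m') π β

theorem modelPullback_one (β : N → Eucl m [⋀^Fin 1]→L[ℝ] ℝ) (p : P) (u : Eucl m') :
    modelPullback π β p ![u] = β (π p) ![dmap π p u] := by
  refine congrArg (β (π p)) ?_
  funext j
  fin_cases j
  rfl

theorem modelPullback_two (β : N → Eucl m [⋀^Fin 2]→L[ℝ] ℝ) (p : P) (u v : Eucl m') :
    modelPullback π β p ![u, v] = β (π p) ![dmap π p u, dmap π p v] := by
  refine congrArg (β (π p)) ?_
  funext j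
  fin_cases j <;> rfl

theorem modelPullback_three (β : N → Eucl m [⋀^Fin 3]→L[ℝ] ℝ) (p : P) (u v w : Eucl m') :
    modelPullback π β p ![u, v, w] = β (π p) ![dmap π p u, dmap π p v, dmap π p w] := by
  refine congrArg (β (π p)) ?_
  funext j
  fin_cases j <;> rfl

/-- A pulled back form vanishes if its first argument is vertical. -/
theorem modelPullback_vertical {k : ℕ} (β : N → Eucl m [⋀^Fin (k + 1)]→L[ℝ] ℝ) {p : P}
    {V : Eucl m'} (hV : dmap (m := m) π p V = 0) (v : Fin k → Eucl m') :
    modelPullback π β p (Matrix.vecCons V v) = 0 :=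
  (β (π p)).map_coord_zero (m := fun j => dmap π p (Matrix.vecCons V v j)) 0 hV

/-- The fundamental form of the almost contact metric structure. -/
def contactForm (g : RMetric (m := m) N) (A : N → Eucl m →L[ℝ] Eucl m) :
    N → Eucl m [⋀^Fin 2]→L[ℝ] ℝ := fundForm (m := m) (RMetric.bil g) A

/-- The exterior derivative of a `1`-form, with values in the model space. -/
def dOne (α : N → Eucl m [⋀^Fin 1]→L[ℝ] ℝ) : N → Eucl m [⋀^Fin 2]→L[ℝ] ℝ := modelExtD α

/-- The exterior derivative of a `2`-form, with values in the model space. -/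
def dTwo (α : N → Eucl m [⋀^Fin 2]→L[ℝ] ℝ) : N → Eucl m [⋀^Fin 3]→L[ℝ] ℝ := modelExtD α

/-- The exterior derivative of a `3`-form, with values in the model space. -/
def dThree (α : N → Eucl m [⋀^Fin 3]→L[ℝ] ℝ) : N → Eucl m [⋀^Fin 4]→L[ℝ] ℝ := modelExtD α

/-- The wedge product of `1`-forms, with values in the model space. -/
def wedgeOneOne (α β : N → Eucl m [⋀^Fin 1]→L[ℝ] ℝ) : N → Eucl m [⋀^Fin 2]→L[ℝ] ℝ :=
  fun x => wedgeAlt (α x) (β x)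

/-- The wedge product of a `1`-form and a `2`-form, with values in the model space. -/
def wedgeOneTwo (α : N → Eucl m [⋀^Fin 1]→L[ℝ] ℝ) (β : N → Eucl m [⋀^Fin 2]→L[ℝ] ℝ) :
    N → Eucl m [⋀^Fin 3]→L[ℝ] ℝ :=
  fun x => wedgeAlt (α x) (β x)

theorem wedgeOneTwo_apply (α : N → Eucl m [⋀^Fin 1]→L[ℝ] ℝ) (β : N → Eucl m [⋀^Fin 2]→L[ℝ] ℝ)
    (x : N) (u v w : Eucl m) : wedgeOneTwo α β x ![u, v, w] =
      α x ![u] * β x ![v, w] - α x ![v] * β x ![u, w] + α x ![w] * β x ![u, v] :=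
  wedgeAlt_one_two _ _ _ _ _

theorem dTwo_wedgeOneOne {α β : N → Eucl m [⋀^Fin 1]→L[ℝ] ℝ}
    (hα : FormSmooth (m := m) α) (hβ : FormSmooth (m := m) β) (x : N) (u v w : Eucl m) :
    dTwo (wedgeOneOne α β) x ![u, v, w] =
      dOne α x ![u, v] * β x ![w] - dOne α x ![u, w] * β x ![v] + dOne α x ![v, w] * β x ![u]
      - (α x ![u] * dOne β x ![v, w] - α x ![v] * dOne β x ![u, w]
        + α x ![w] * dOne β x ![u, v]) :=
  modelExtD_wedge_one_one hα hβ x u v w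

/-- The component `I dω - dη ∧ η` of the torsion. -/
def torsionB (g : RMetric (m := m) N) (A : N → Eucl m →L[ℝ] Eucl m) (η : N → Eucl m →L[ℝ] ℝ) :
    N → Eucl m [⋀^Fin 3]→L[ℝ] ℝ :=
  act (m := m) A (extD (m := m) (contactForm g A)) -
    wedge (m := m) (extD (m := m) (oneForm η)) (oneForm η)

/-- The component `I (i_ξ dω)` of the torsion. -/
def torsionC (g : RMetric (m := m) N) (A : N → Eucl m →L[ℝ] Eucl m) (ξ : N → Eucl m) :
    N → Eucl m [⋀^Fin 2]→L[ℝ] ℝ :=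
  act (m := m) A (contract (m := m) ξ (extD (m := m) (contactForm g A)))

/-- A field of covectors as a `1`-form, with values in the model space. -/
def modelOneForm (η : N → Eucl m →L[ℝ] ℝ) : N → Eucl m [⋀^Fin 1]→L[ℝ] ℝ := oneForm (m := m) η

theorem modelOneForm_apply (η : N → Eucl m →L[ℝ] ℝ) (x : N) (u : Eucl m) :
    modelOneForm η x ![u] = η x u := rfl

theorem torsionB_apply (x : N) (u v w : Eucl m) :
    torsionB g A η x ![u, v, w] =
      dTwo (contactForm g A) x ![A x u, A x v, A x w] -
      (dOne (modelOneForm η) x ![u, v] * η x w - dOne (modelOneForm η) x ![u, w] * η x v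
        + dOne (modelOneForm η) x ![v, w] * η x u) := by
  have h1 : torsionB g A η x ![u, v, w] =
      dTwo (contactForm g A) x (A x ∘ ![u, v, w]) -
        wedgeAlt (dOne (modelOneForm η) x) (modelOneForm η x) ![u, v, w] := rfl
  rw [h1, wedgeAlt_two_one]
  congr 1
  refine congrArg (dTwo (contactForm g A) x) ?_
  funext j
  fin_cases j <;> rfl

theorem torsionC_apply (x : N) (u v : Eucl m) :
    torsionC g A ξ x ![u, v] = dTwo (contactForm g A) x ![ξ x, A x u, A x v] := by
  refine congrArg (dTwo (contactForm g A) x) ?_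
  funext j
  fin_cases j <;> rfl

theorem IsAlmostContactMetric.formSmooth_contactForm
    (H : IsAlmostContactMetric (m := m) A ξ η g) : FormSmooth (m := m) (contactForm g A) :=
  formSmooth_fundForm (RMetric.contDiffAt_locBil g) H.smooth_end

theorem IsAlmostContactMetric.formSmooth_torsionB
    (H : IsAlmostContactMetric (m := m) A ξ η g) : FormSmooth (m := m) (torsionB g A η) := by
  have hη : FormSmooth (m := m) (oneForm η) := H.smooth_form.formSmooth
  have h1 : FormSmooth (m := m) (dTwo (contactForm g A)) := H.formSmooth_contactForm.extD
  have h2 : FormSmooth (m := m) (dOne (modelOneForm η)) := hη.extD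
  exact (FormSmooth.act H.smooth_end h1).sub (FormSmooth.wedge h2 hη)

theorem IsAlmostContactMetric.formSmooth_torsionC
    (H : IsAlmostContactMetric (m := m) A ξ η g) : FormSmooth (m := m) (torsionC g A ξ) := by
  have h1 : FormSmooth (m := m) (dTwo (contactForm g A)) := H.formSmooth_contactForm.extD
  have h2 : FormSmooth (m := m) (contract (m := m) ξ (dTwo (contactForm g A))) :=
    FormSmooth.contract H.smooth_vector h1
  exact FormSmooth.act (α := contract (m := m) ξ (dTwo (contactForm g A))) H.smooth_end h2

/-- The exterior derivative of `η` is invariant under `A` and annihilates `ξ`. -/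
theorem IsAlmostContactMetric.extD_apply (H : IsAlmostContactMetric (m := m) A ξ η g)
    (hn : IsNormal (m := m) A ξ η) (x : N) (u v : Eucl m) (s t : ℝ) :
    dOne (modelOneForm η) x ![A x u + s • ξ x, A x v + t • ξ x] =
      dOne (modelOneForm η) x ![u, v] := by
  have hη : FormSmooth (m := m) (oneForm η) := H.smooth_form.formSmooth
  have e := extD_oneForm hη x
  have e' : ∀ a b : Eucl m, dOne (modelOneForm η) x ![a, b] = _ := e
  have K := normalJet H hn x
  have hξ : ∀ v, dOne (modelOneForm η) x ![ξ x, v] = 0 := fun v =>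
    (e' _ _).trans (K.lie_eta v)
  have hA : ∀ u v, dOne (modelOneForm η) x ![A x u, A x v] =
      dOne (modelOneForm η) x ![u, v] := fun u v =>
    (e' _ _).trans ((K.extD_invariant u v).trans (e' _ _).symm)
  simp only [alt_two_add, alt_two_smul, alt_two_add_right, alt_two_smul_right, hξ, hA,
    alt_swap (dOne (modelOneForm η) x) _ (ξ x)]
  ring

/-- In `h(X, JY)` the part `θ(Y) ξ` of `π_* JY` gives `η(X) θ(Y)`, because `g(·, ξ) = η`, and `θ(JY)
= -η(Y)` gives `-θ(X) η(Y)`. Together they form `π^*η ∧ θ`. -/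
theorem fundForm_eq (hh : IsInducedMetric π θ g h) (HJ : IsInduced π θ A ξ η J)
    (H : IsAlmostContactMetric (m := m) A ξ η g) (hJ : IsComplexStructure (m := m') J) :
    fundForm (m := m') h J = modelPullback π (contactForm g A) +
      wedgeOneOne (modelPullback π (modelOneForm η)) (modelOneForm θ) := by
  have key : ∀ (p : P) (u v : Eucl m'), h p u (J p v) =
      modelPullback π (contactForm g A) p ![u, v] +
        wedgeAlt (modelPullback π (modelOneForm η) p) (modelOneForm θ p) ![u, v] := by
    intro p u v
    have h1 : contactForm g A (π p) ![dmap π p u, dmap π p v] =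
        RMetric.bil g (π p) (dmap π p u) (A (π p) (dmap π p v)) := H.fundForm_apply (π p) _ _
    rw [wedgeAlt_one_one, modelPullback_two, h1, modelPullback_one, modelPullback_one,
      modelOneForm_apply, modelOneForm_apply, modelOneForm_apply, modelOneForm_apply, hh,
      HJ.theta, HJ.proj, map_add, map_smul, H.bil_xi, smul_eq_mul]
    ring
  funext p
  ext v
  rw [vec_two v]
  refine (CircleHKT.fundForm_apply (m := m') h J p (fun v w => hh.skew HJ H hJ p v w) _ _).trans ?_
  exact key p (v 0) (v 1)

/-- Expanding `dω` on vectors `Au + θ(u) ξ` gives `π^*(A dω) + θ ∧ π^*C`. Since `J` takes `π^*η` to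
`θ` and `θ` to `-π^*η` and preserves `π^*dη` and `π^*Ω`, the derivative of `π^*η ∧ θ` contributes
`-π^*(dη ∧ η) - θ ∧ π^*Ω`. -/
theorem torsion_apply (S : IsSplitting (m := m) π θ)
    (HJ : IsInduced π θ A ξ η J) (H : IsAlmostContactMetric (m := m) A ξ η g)
    (hn : IsNormal (m := m) A ξ η) (hΩ : act (m := m) A Ω = Ω)
    (hcurv : extD (m := m') (oneForm θ) = pullback (m := m) (m' := m') π Ω)
    (p : P) (u v w : Eucl m') :
    modelPullback π (dTwo (contactForm g A)) p ![J p u, J p v, J p w] +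
        dTwo (wedgeOneOne (modelPullback π (modelOneForm η)) (modelOneForm θ)) p
          ![J p u, J p v, J p w] =
      modelPullback π (torsionB g A η) p ![u, v, w] + wedgeOneTwo (modelOneForm θ)
        (modelPullback π (torsionC g A ξ) - modelPullback π Ω) p ![u, v, w] := by
  have hη : FormSmooth (m := m) (modelOneForm η) := H.smooth_form.formSmooth
  have hη' : FormSmooth (m := m') (modelPullback π (modelOneForm η)) :=
    FormSmooth.pullback S.smooth_proj hη
  have hθ : FormSmooth (m := m') (modelOneForm θ) := S.smooth_form
  have e2 : dOne (modelPullback (m' := m') π (modelOneForm η)) =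
      modelPullback π (dOne (modelOneForm η)) := extD_pullback S.smooth_proj hη
  have e3 : dOne (modelOneForm θ) = modelPullback π Ω := hcurv
  have hinv : ∀ x (u v : Eucl m) (s t : ℝ), Ω x ![A x u + s • ξ x, A x v + t • ξ x] = Ω x ![u, v] := by
    intro x u v s t
    simp only [alt_two_add, alt_two_smul, H.inv_xi hΩ, alt_two_add_right, alt_two_smul_right,
      inv_apply hΩ, alt_swap (Ω x) _ (ξ x)]
    ring
  have h1 : ∀ x (u : Eucl m), η x (A x u) = 0 := H.eta_apply
  have h2 : ∀ x, η x (ξ x) = 1 := H.eta_xi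
  rw [dTwo_wedgeOneOne hη' hθ, wedgeOneTwo_apply, e2, e3, Pi.sub_apply]
  simp only [ContinuousAlternatingMap.sub_apply, modelPullback_one, modelPullback_two, modelPullback_three,
    HJ.proj, modelOneForm_apply, HJ.theta, H.extD_apply hn, hinv, alt_three_expand,
    torsionB_apply, torsionC_apply, map_add, map_smul, h1, h2, smul_eq_mul]
  ring
/-- The torsion of the induced structure is, up to sign, `π^* B + θ ∧ π^* (C - Ω)`. -/
theorem JdF_eq (S : IsSplitting (m := m) π θ) (hh : IsInducedMetric π θ g h)
    (HJ : IsInduced π θ A ξ η J) (H : IsAlmostContactMetric (m := m) A ξ η g)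
    (hn : IsNormal (m := m) A ξ η) (hJ : IsComplexStructure (m := m') J)
    (hΩ : act (m := m) A Ω = Ω)
    (hcurv : extD (m := m') (oneForm θ) = pullback (m := m) (m' := m') π Ω) :
    JdF (m := m') J h = modelPullback π (torsionB g A η) +
      wedgeOneTwo (modelOneForm θ) (modelPullback π (torsionC g A ξ) - modelPullback π Ω) := by
  have hη : FormSmooth (m := m) (modelOneForm η) := H.smooth_form.formSmooth
  have hη' : FormSmooth (m := m') (modelPullback π (modelOneForm η)) :=
    FormSmooth.pullback S.smooth_proj hη
  have hθ : FormSmooth (m := m') (modelOneForm θ) := S.smooth_form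
  have hω := H.formSmooth_contactForm
  have e1 : extD (m := m') (fundForm (m := m') h J) =
      modelPullback π (dTwo (contactForm g A)) +
        dTwo (wedgeOneOne (modelPullback π (modelOneForm η)) (modelOneForm θ)) := by
    rw [fundForm_eq hh HJ H hJ]
    refine (extD_add (FormSmooth.pullback S.smooth_proj hω) (FormSmooth.wedge hη' hθ)).trans ?_
    rw [extD_pullback S.smooth_proj hω]
    rfl
  funext p
  ext v
  rw [vec_three v]
  have e4 : JdF (m := m') J h p ![v 0, v 1, v 2] =
      extD (m := m') (fundForm (m := m') h J) p (J p ∘ ![v 0, v 1, v 2]) := rfl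
  have e5 : (J p ∘ ![v 0, v 1, v 2] : Fin 3 → Eucl m') =
      ![J p (v 0), J p (v 1), J p (v 2)] := by
    funext j
    fin_cases j <;> rfl
  refine e4.trans ?_
  rw [e1]
  refine Eq.trans ?_ (torsion_apply S HJ H hn hΩ hcurv p (v 0) (v 1) (v 2))
  rw [← e5]
  rfl

end Torsion

/-! ### The torsion conditions -/

section Conditions

variable {m m' : ℕ}
  {N : Type*} [TopologicalSpace N] [ChartedSpace (Eucl m) N] [IsManifold (𝓡 m) ∞ N]
  {P : Type*} [TopologicalSpace P] [ChartedSpace (Eucl m') P] [IsManifold (𝓡 m') ∞ P]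
  {π : P → N} {θ : P → Eucl m' →L[ℝ] ℝ} {b b' : N → Eucl m [⋀^Fin 3]→L[ℝ] ℝ}
  {c c' Ω : N → Eucl m [⋀^Fin 2]→L[ℝ] ℝ}

/-- The form `π^* b + θ ∧ π^* (c - Ω)`. -/
def torsionForm (π : P → N) (θ : P → Eucl m' →L[ℝ] ℝ) (b : N → Eucl m [⋀^Fin 3]→L[ℝ] ℝ)
    (c Ω : N → Eucl m [⋀^Fin 2]→L[ℝ] ℝ) : P → Eucl m' [⋀^Fin 3]→L[ℝ] ℝ :=
  modelPullback π b + wedgeOneTwo (modelOneForm θ) (modelPullback π c - modelPullback π Ω)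

theorem torsionForm_apply (p : P) (u v w : Eucl m') :
    torsionForm π θ b c Ω p ![u, v, w] = modelPullback π b p ![u, v, w] +
      (θ p u * (modelPullback π c p ![v, w] - modelPullback π Ω p ![v, w])
      - θ p v * (modelPullback π c p ![u, w] - modelPullback π Ω p ![u, w])
      + θ p w * (modelPullback π c p ![u, v] - modelPullback π Ω p ![u, v])) := by
  have h1 : torsionForm π θ b c Ω p ![u, v, w] = modelPullback π b p ![u, v, w] +
    wedgeOneTwo (modelOneForm θ) (modelPullback π c - modelPullback π Ω) p ![u, v, w] := rfl
  rw [h1, wedgeOneTwo_apply]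
  rfl

theorem IsSplitting.exists_vertical (S : IsSplitting (m := m) π θ) (p : P) :
    ∃ V : Eucl m', dmap (m := m) π p V = 0 ∧ θ p V = 1 := by
  obtain ⟨V, hV⟩ := (S.invertible p).surjective ((0 : Eucl m), (1 : ℝ))
  exact ⟨V, congrArg Prod.fst hV, congrArg Prod.snd hV⟩

/-- Inserting a vertical vector with `θ = 1` kills the pulled back forms that contain it and leaves
`π^*(c - Ω)`. Once the `c` parts agree, the common summand cancels. -/
theorem torsionForm_eq_iff (S : IsSplitting (m := m) π θ) :
    torsionForm π θ b c Ω = torsionForm π θ b' c' Ω ↔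
      modelPullback (m' := m') π b = modelPullback π b' ∧
        modelPullback (m' := m') π c = modelPullback π c' := by
  refine ⟨fun H => ?_, fun H => by rw [torsionForm, torsionForm, H.1, H.2]⟩
  have hc : modelPullback (m' := m') π c = modelPullback π c' := by
    funext p
    ext v
    rw [vec_two v]
    obtain ⟨V, hV, hθ⟩ := S.exists_vertical p
    have h := congrArg (fun T : P → Eucl m' [⋀^Fin 3]→L[ℝ] ℝ => T p ![V, v 0, v 1]) H
    simp only [torsionForm_apply, modelPullback_vertical _ hV, hθ] at h
    linarith
  refine ⟨?_, hc⟩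
  rw [torsionForm, torsionForm, hc] at H
  exact add_right_cancel H

theorem modelPullback_extD (hπ : ContMDiff (𝓡 m') (𝓡 m) ∞ π) {k : ℕ}
    {α : N → Eucl m [⋀^Fin k]→L[ℝ] ℝ} (hα : FormSmooth (m := m) α) :
    modelExtD (modelPullback (m' := m') π α) = modelPullback π (modelExtD α) :=
  extD_pullback hπ hα

/-- The wedge product of `2`-forms, with values in the model space. -/
def wedgeTwoTwo (α β : N → Eucl m [⋀^Fin 2]→L[ℝ] ℝ) : N → Eucl m [⋀^Fin 4]→L[ℝ] ℝ :=
  fun x => wedgeAlt (α x) (β x)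

theorem wedgeTwoTwo_apply (α β : N → Eucl m [⋀^Fin 2]→L[ℝ] ℝ) (x : N) (u v w z : Eucl m) :
    wedgeTwoTwo α β x ![u, v, w, z] =
      α x ![u, v] * β x ![w, z] - α x ![u, w] * β x ![v, z] + α x ![u, z] * β x ![v, w]
      + α x ![v, w] * β x ![u, z] - α x ![v, z] * β x ![u, w] + α x ![w, z] * β x ![u, v] :=
  wedgeAlt_two_two _ _ _ _ _ _

theorem dThree_wedgeOneTwo {α : N → Eucl m [⋀^Fin 1]→L[ℝ] ℝ} {β : N → Eucl m [⋀^Fin 2]→L[ℝ] ℝ}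
    (hα : FormSmooth (m := m) α) (hβ : FormSmooth (m := m) β) (x : N) (u v w z : Eucl m) :
    dThree (wedgeOneTwo α β) x ![u, v, w, z] =
      wedgeTwoTwo (dOne α) β x ![u, v, w, z] -
      (α x ![u] * dTwo β x ![v, w, z] - α x ![v] * dTwo β x ![u, w, z]
        + α x ![w] * dTwo β x ![u, v, z] - α x ![z] * dTwo β x ![u, v, w]) :=
  modelExtD_wedge_one_two hα hβ x u v w z

/-- Leibniz rule with `dθ = π^*Ω` and `d(c - Ω) = dc`. -/
theorem dThree_torsionForm (S : IsSplitting (m := m) π θ) (hb : FormSmooth (m := m) b)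
    (hc : FormSmooth (m := m) c) (hΩ : FormSmooth (m := m) Ω) (hd : dTwo Ω = 0)
    (hcurv : dOne (modelOneForm θ) = modelPullback π Ω) (p : P) (u v w z : Eucl m') :
    dThree (torsionForm π θ b c Ω) p ![u, v, w, z] =
      modelPullback π (dThree b) p ![u, v, w, z] +
      wedgeTwoTwo (modelPullback π Ω) (modelPullback π (c - Ω)) p ![u, v, w, z] -
      (θ p u * modelPullback π (dTwo c) p ![v, w, z] - θ p v * modelPullback π (dTwo c) p ![u, w, z]
        + θ p w * modelPullback π (dTwo c) p ![u, v, z]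
        - θ p z * modelPullback π (dTwo c) p ![u, v, w]) := by
  have hθ : FormSmooth (m := m') (modelOneForm θ) := S.smooth_form
  have hb' : FormSmooth (m := m') (modelPullback π b) := FormSmooth.pullback S.smooth_proj hb
  have hκ : FormSmooth (m := m) (c - Ω) := hc.sub hΩ
  have hκ' : FormSmooth (m := m') (modelPullback π (c - Ω)) :=
    FormSmooth.pullback S.smooth_proj hκ
  have e0 : torsionForm π θ b c Ω =
    modelPullback π b + wedgeOneTwo (modelOneForm θ) (modelPullback π (c - Ω)) := rfl
  have e1 : dThree (torsionForm π θ b c Ω) = dThree (modelPullback π b) +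
      dThree (wedgeOneTwo (modelOneForm θ) (modelPullback π (c - Ω))) := by
    rw [e0]
    exact extD_add hb' (FormSmooth.wedge hθ hκ')
  have e2 : dThree (modelPullback (m' := m') π b) = modelPullback π (dThree b) :=
    modelPullback_extD S.smooth_proj hb
  have e3 : dTwo (modelPullback (m' := m') π (c - Ω)) = modelPullback π (dTwo (c - Ω)) :=
    modelPullback_extD S.smooth_proj hκ
  have e4 : dTwo (c - Ω) = dTwo c := by
    have h : dTwo (c - Ω) = dTwo c - dTwo Ω := extD_sub hc hΩ
    rw [h, hd, sub_zero]
  rw [e1, Pi.add_apply, ContinuousAlternatingMap.add_apply, dThree_wedgeOneTwo hθ hκ', e2, e3, e4,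
    hcurv]
  simp only [modelOneForm_apply]
  ring

/-- All terms except `-θ ∧ π^*dc` are horizontal, so a vertical argument isolates `π^*dc`; the rest
is the second equation. -/
theorem dThree_torsionForm_eq_zero_iff (S : IsSplitting (m := m) π θ)
    (hb : FormSmooth (m := m) b) (hc : FormSmooth (m := m) c) (hΩ : FormSmooth (m := m) Ω)
    (hd : dTwo Ω = 0) (hcurv : dOne (modelOneForm θ) = modelPullback π Ω) :
    dThree (torsionForm π θ b c Ω) = 0 ↔ dTwo (modelPullback (m' := m') π c) = 0 ∧
      dThree (modelPullback (m' := m') π b) =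
        wedgeTwoTwo (-modelPullback π c + modelPullback π Ω) (modelPullback π Ω) := by
  have key := dThree_torsionForm S hb hc hΩ hd hcurv
  have e2 : dThree (modelPullback (m' := m') π b) = modelPullback π (dThree b) :=
    modelPullback_extD S.smooth_proj hb
  have e3 : dTwo (modelPullback (m' := m') π c) = modelPullback π (dTwo c) :=
    modelPullback_extD S.smooth_proj hc
  -- Forms of degree two commute, so `(-c + Ω) ∧ Ω = -Ω ∧ (c - Ω)` after pullback.
  have e4 : ∀ p (u v w z : Eucl m'),
      wedgeTwoTwo (-modelPullback π c + modelPullback π Ω) (modelPullback π Ω) p ![u, v, w, z] =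
        -wedgeTwoTwo (modelPullback π Ω) (modelPullback π (c - Ω)) p ![u, v, w, z] := by
    intro p u v w z
    have h1 : ∀ a a' : Eucl m',
        (-modelPullback π c + modelPullback π Ω : P → Eucl m' [⋀^Fin 2]→L[ℝ] ℝ) p ![a, a'] =
        -modelPullback π c p ![a, a'] + modelPullback π Ω p ![a, a'] := fun _ _ => rfl
    have h2 : ∀ a a' : Eucl m', modelPullback (m' := m') π (c - Ω) p ![a, a'] =
        modelPullback π c p ![a, a'] - modelPullback π Ω p ![a, a'] := fun _ _ => rfl
    simp only [wedgeTwoTwo_apply, h1, h2]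
    ring
  rw [e2, e3]
  constructor
  · intro H
    have H' : ∀ p (u v w z : Eucl m'), dThree (torsionForm π θ b c Ω) p ![u, v, w, z] = 0 :=
      fun p u v w z => by rw [H]; rfl
    have hC : modelPullback (m' := m') π (dTwo c) = 0 := by
      funext p
      ext v
      rw [vec_three v]
      obtain ⟨V, hV, hθ⟩ := S.exists_vertical p
      have h := H' p V (v 0) (v 1) (v 2)
      have h0 : (0 : P → Eucl m' [⋀^Fin 3]→L[ℝ] ℝ) p ![v 0, v 1, v 2] = 0 := rfl
      rw [key, wedgeTwoTwo_apply] at h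
      simp only [modelPullback_vertical _ hV, hθ] at h
      linarith
    refine ⟨hC, ?_⟩
    funext p
    ext v
    rw [vec_four v, e4]
    have h := H' p (v 0) (v 1) (v 2) (v 3)
    have hz : ∀ x y z : Eucl m', (0 : P → Eucl m' [⋀^Fin 3]→L[ℝ] ℝ) p ![x, y, z] = 0 :=
      fun _ _ _ => rfl
    rw [key, hC] at h
    simp only [hz] at h
    linarith
  · rintro ⟨hC, hB⟩
    funext p
    ext v
    rw [vec_four v, key, hC, hB, e4]
    simp

end Conditions

/-! ### Assembly of the three assertions. -/

section Main

variable {m m' : ℕ}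
  {N : Type*} [TopologicalSpace N] [ChartedSpace (Eucl m) N] [IsManifold (𝓡 m) ∞ N]
  {P : Type*} [TopologicalSpace P] [ChartedSpace (Eucl m') P] [IsManifold (𝓡 m') ∞ P]
  {π : P → N} {θ : P → Eucl m' →L[ℝ] ℝ} {g : RMetric (m := m) N}
  {h : P → Eucl m' →L[ℝ] Eucl m' →L[ℝ] ℝ}
  {A : Fin 3 → N → Eucl m →L[ℝ] Eucl m} {ξ : Fin 3 → N → Eucl m}
  {η : Fin 3 → N → Eucl m →L[ℝ] ℝ} {J : Fin 3 → P → Eucl m' →L[ℝ] Eucl m'}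
  {Ω : N → Eucl m [⋀^Fin 2]→L[ℝ] ℝ}

/-- The data on `P` enter only through their defining equations, and tangent spaces are replaced by
the model spaces, so the local calculus above applies directly. -/
theorem hkt_of_isInduced (S : IsSplitting (m := m) π θ)
    (hh : IsInducedMetric π θ g h) (HJ : ∀ r, IsInduced π θ (A r) (ξ r) (η r) (J r))
    (H : ∀ r, IsAlmostContactMetric (m := m) (A r) (ξ r) (η r) g)
    (hn : ∀ r, IsNormal (m := m) (A r) (ξ r) (η r))
    (hq : QuaternionicRelations (m := m) A ξ η)
    (hΩs : FormSmooth (m := m) Ω) (hd : extD (m := m) Ω = 0)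
    (hΩ : ∀ r, act (m := m) (A r) Ω = Ω)
    (hcurv : extD (m := m') (oneForm θ) = pullback (m := m) (m' := m') π Ω) :
    IsHyperHermitian (m := m') J h ∧
    (IsHKT (m := m') J h ↔
      (modelPullback (m' := m') π (torsionB g (A 0) (η 0)) =
          modelPullback π (torsionB g (A 1) (η 1)) ∧
        modelPullback (m' := m') π (torsionB g (A 1) (η 1)) =
          modelPullback π (torsionB g (A 2) (η 2))) ∧
      (modelPullback (m' := m') π (torsionC g (A 0) (ξ 0)) =
          modelPullback π (torsionC g (A 1) (ξ 1)) ∧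
        modelPullback (m' := m') π (torsionC g (A 1) (ξ 1)) =
          modelPullback π (torsionC g (A 2) (ξ 2)))) ∧
    (IsHKT (m := m') J h →
      (IsStrongHKT (m := m') J h ↔ ∀ r,
        dTwo (modelPullback (m' := m') π (torsionC g (A r) (ξ r))) = 0 ∧
        dThree (modelPullback (m' := m') π (torsionB g (A r) (η r))) =
          wedgeTwoTwo (-modelPullback π (torsionC g (A r) (ξ r)) + modelPullback π Ω)
            (modelPullback π Ω))) := by
  have hHH := isHyperHermitian_of_isInduced S hh HJ H hn hq hΩ hcurv
  have hT : ∀ r, JdF (m := m') (J r) h =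
      torsionForm π θ (torsionB g (A r) (η r)) (torsionC g (A r) (ξ r)) Ω :=
    fun r => JdF_eq S hh (HJ r) (H r) (hn r) (hHH.complex r) (hΩ r) hcurv
  have hHKT : IsHKT (m := m') J h ↔
      (modelPullback (m' := m') π (torsionB g (A 0) (η 0)) =
          modelPullback π (torsionB g (A 1) (η 1)) ∧
        modelPullback (m' := m') π (torsionB g (A 1) (η 1)) =
          modelPullback π (torsionB g (A 2) (η 2))) ∧
      (modelPullback (m' := m') π (torsionC g (A 0) (ξ 0)) =
          modelPullback π (torsionC g (A 1) (ξ 1)) ∧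
        modelPullback (m' := m') π (torsionC g (A 1) (ξ 1)) =
          modelPullback π (torsionC g (A 2) (ξ 2))) := by
    have e : IsHKT (m := m') J h ↔ IsHyperHermitian (m := m') J h ∧
      JdF (m := m') (J 0) h = JdF (m := m') (J 1) h ∧
        JdF (m := m') (J 1) h = JdF (m := m') (J 2) h := Iff.rfl
    rw [hT, hT, hT] at e
    refine (e.trans (and_iff_right hHH)).trans ((and_congr (torsionForm_eq_iff S)
      (torsionForm_eq_iff S)).trans ?_)
    tauto
  refine ⟨hHH, hHKT, fun hK => ?_⟩
  obtain ⟨⟨hB1, hB2⟩, hC1, hC2⟩ := hHKT.1 hK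
  have h0 := dThree_torsionForm_eq_zero_iff S (H 0).formSmooth_torsionB
    (H 0).formSmooth_torsionC hΩs hd hcurv
  have hneg : IsStrongHKT (m := m') J h ↔
      dThree (torsionForm π θ (torsionB g (A 0) (η 0)) (torsionC g (A 0) (ξ 0)) Ω) = 0 := by
    have e : IsStrongHKT (m := m') J h ↔ IsHKT (m := m') J h ∧
      extD (m := m') (-JdF (m := m') (J 0) h) = 0 := Iff.rfl
    rw [extD_neg, hT] at e
    exact (e.trans (and_iff_right hK)).trans neg_eq_zero
  rw [hneg, h0]
  -- Strongness concerns only the torsion computed from `J 0`. Under the HKT condition the pulled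
  -- back components are the same for all `r`, so its two equations hold for every index.
  refine ⟨fun hr r => ?_, fun hr => hr 0⟩
  fin_cases r
  · exact hr
  · change dTwo (modelPullback (m' := m') π (torsionC g (A 1) (ξ 1))) = 0 ∧
      dThree (modelPullback (m' := m') π (torsionB g (A 1) (η 1))) =
        wedgeTwoTwo (-modelPullback π (torsionC g (A 1) (ξ 1)) + modelPullback π Ω)
          (modelPullback π Ω)
    rwa [← hC1, ← hB1]
  · change dTwo (modelPullback (m' := m') π (torsionC g (A 2) (ξ 2))) = 0 ∧
      dThree (modelPullback (m' := m') π (torsionB g (A 2) (η 2))) =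
        wedgeTwoTwo (-modelPullback π (torsionC g (A 2) (ξ 2)) + modelPullback π Ω)
          (modelPullback π Ω)
    rwa [← hC2, ← hC1, ← hB2, ← hB1]

end Main

end

end CircleHKT

theorem mainTheorem9 (n : ℕ)
    {N : Type*} [TopologicalSpace N] [T2Space N] [SecondCountableTopology N]
    [ChartedSpace (EuclideanSpace ℝ (Fin (4 * n + 3))) N] [IsManifold (𝓡 (4 * n + 3)) ∞ N]
    {P : Type*} [TopologicalSpace P] [T2Space P] [SecondCountableTopology P]
    [ChartedSpace (EuclideanSpace ℝ (Fin (4 * n + 4))) P] [IsManifold (𝓡 (4 * n + 4)) ∞ P]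
    -- three normal almost contact metric structures in quaternionic relation
    (I : Fin 3 → EndField (m := 4 * n + 3) N) (ξ : Fin 3 → VField (m := 4 * n + 3) N)
    (η : Fin 3 → CoField (m := 4 * n + 3) N) (g : RMetric (m := 4 * n + 3) N)
    (hI : ∀ r, IsAlmostContactMetric (I r) (ξ r) (η r) g)
    (hnormal : ∀ r, IsNormal (I r) (ξ r) (η r))
    (hquat : QuaternionicRelations I ξ η)
    -- the closed invariant form
    (Ω : DForm (m := 4 * n + 3) N 2) (hΩ : SmoothForm Ω) (hΩclosed : extD Ω = 0)
    (hΩinv : ∀ r, act (I r) Ω = Ω)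
    -- the circle bundle with connection form of curvature Ω
    [MulAction Circle P] (π : P → N)
    (hπ : IsPrincipalCircleBundle (4 * n + 3) (4 * n + 4) π)
    (θ : CoField (m := 4 * n + 4) P) (hθ : IsConnectionForm θ)
    (hcurv : extD (oneForm θ) = pullback π Ω) :
    let J : Fin 3 → EndField (m := 4 * n + 4) P := fun r => bundleJ π θ (I r) (ξ r) (η r)
    let h : BilinField (m := 4 * n + 4) P := bundleMetric π θ g
    let F : Fin 3 → DForm (m := 4 * n + 3) N 2 := fun r => fundForm (fun x => g.inner x) (I r)
    let B : Fin 3 → DForm (m := 4 * n + 3) N 3 := fun r =>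
      act (I r) (extD (F r)) - wedge (extD (oneForm (η r))) (oneForm (η r))
    let C : Fin 3 → DForm (m := 4 * n + 3) N 2 := fun r =>
      act (I r) (contract (ξ r) (extD (F r)))
    IsHyperHermitian J h ∧
    (IsHKT J h ↔
      (pullback (m' := 4 * n + 4) π (B 0) = pullback π (B 1) ∧
        pullback (m' := 4 * n + 4) π (B 1) = pullback π (B 2)) ∧
      (pullback (m' := 4 * n + 4) π (C 0) = pullback π (C 1) ∧
        pullback (m' := 4 * n + 4) π (C 1) = pullback π (C 2))) ∧
    (IsHKT J h →
      (IsStrongHKT J h ↔ ∀ r,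
        extD (pullback (m' := 4 * n + 4) π (C r)) = 0 ∧
        extD (pullback (m' := 4 * n + 4) π (B r)) =
          wedge (- pullback (m' := 4 * n + 4) π (C r) + pullback π Ω) (pullback π Ω))) := by
  -- Invertibility of the splitting supplies the vertical vectors and the componentwise arguments
  -- used above.
  have S : IsSplitting (m := 4 * n + 3) π θ :=
    ⟨hπ.smooth_proj, hθ.smooth.formSmooth, split_isInvertible hπ hθ⟩
  have HJ : ∀ r, IsInduced π θ (I r) (ξ r) (η r) (bundleJ π θ (I r) (ξ r) (η r)) := fun r =>
    ⟨fun p v => (bundleJ_spec hπ hθ (I r) (ξ r) (η r) p v).1,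
      fun p v => (bundleJ_spec hπ hθ (I r) (ξ r) (η r) p v).2⟩
  exact hkt_of_isInduced S (h := bundleMetric π θ g) (fun p v w => bundleMetric_apply π θ g p v w)
    HJ hI hnormal hquat hΩ.formSmooth hΩclosed hΩinv hcurv
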